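/- Let $N \ge 2$ be an integer and let $x \in \mathbb R$. On $V = (\mathbb C^3)^{\otimes N}$ consider the spin-one XXZ Hamiltonian $$H = \sum_{j=1}^N \Big( \sum_{a=1}^3 J_a \big( s_j^a s_{j+1}^a + 2 (s_j^a)^2 \big) - \sum_{a,b=1}^3 A_{ab}\, s_j^a s_j^b s_{j+1}^a s_{j+1}^b \Big),$$ where $s_j^a$ acts at site $j$ as the spin-one matrix $$s^1 = \tfrac{1}{\sqrt 2}\begin{pmatrix} 0&1&0\\1&0&1\\0&1&0\end{pmatrix},\quad s^2 = \tfrac{1}{\sqrt 2}\begin{pmatrix} 0&-i&0\\i&0&-i\\0&i&0\end{pmatrix},\quad s^3 = \begin{pmatrix} 1&0&0\\0&0&0\\0&0&-1\end{pmatrix},$$ and where $J_1=J_2=1$, $J_3=\tfrac12(x^2-2)$, $A_{ab}=A_{ba}$, $A_{aa}=J_a$, $A_{12}=1$, $A_{13}=A_{23}=x-1$. The operators $s_{N+1}^a$ are given by one of the following boundary conditions: the diagonal twist $s_{N+1}^1=-s_1^1$, $s_{N+1}^2=-s_1^2$, $s_{N+1}^3=s_1^3$, or the anti-diagonal twist $s_{N+1}^1=s_1^1$,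 $s_{N+1}^2=-s_1^2$, $s_{N+1}^3=-s_1^3$. Let $M=\sum_{j=1}^N s_j^3$ be the total magnetisation and let $F = \begin{pmatrix} 0&0&1\\0&1&0\\1&0&0\end{pmatrix}^{\otimes N}$ be the spin-flip operator. (i) For the anti-diagonal twist, $H$ preserves the eigenspaces of $(-1)^M$ for the eigenvalues $1$ and $-1$, and the non-zero parts of the spectra of the restrictions of $H$ to these two eigenspaces coincide, including degeneracies: every $E \neq 0$ has an eigenspace of the same dimension (possibly $0$) for the two restrictions. (ii) For the diagonal twist, $H$ preserves the eigenspaces of $F$ for the eigenvalues $1$ and $-1$, and the non-zero parts of the spectra of the restrictions of $H$ to these two eigenspaces coincide, including degeneracies, in the same sense. -/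

import Mathlib

namespace SpinOneXXZ

noncomputable section

/-- Operators on the Hilbert space `(ℂ³)^{⊗N}`, as matrices in the canonical basis. A basis state
`|σ₁ ⋯ σ_N⟩` is a configuration `σ : Fin N → Fin 3`, where the values `0, 1, 2` of `σ j` stand for
spin up, spin zero and spin down at the site `j`. Sites are numbered from `0`. -/
abbrev Op (N : ℕ) : Type := Matrix (Fin N → Fin 3) (Fin N → Fin 3) ℂ

/-- The spin-one matrices `s¹, s², s³`, indexed by `0, 1, 2`. -/
def spin : Fin 3 → Matrix (Fin 3) (Fin 3) ℂ :=
  ![((1 / Real.sqrt 2 : ℝ) : ℂ) • !![0, 1, 0; 1, 0, 1; 0, 1, 0],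
    ((1 / Real.sqrt 2 : ℝ) : ℂ) •
      !![0, -Complex.I, 0; Complex.I, 0, -Complex.I; 0, Complex.I, 0],
    !![1, 0, 0; 0, 0, 0; 0, 0, -1]]

/-- The tensor product `A₁ ⊗ ⋯ ⊗ A_N` of one-site operators. -/
def tensorOp {N : ℕ} (A : Fin N → Matrix (Fin 3) (Fin 3) ℂ) : Op N :=
  Matrix.of fun σ τ => ∏ k, A k (σ k) (τ k)

/-- The one-site operator `A` acting at the site `j`, and as the identity elsewhere. -/
def siteOp {N : ℕ} (j : Fin N) (A : Matrix (Fin 3) (Fin 3) ℂ) : Op N :=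
  tensorOp (Function.update (fun _ => 1) j A)

/-- The coupling constants `J_a`. -/
def coupJ (x : ℝ) : Fin 3 → ℝ := ![1, 1, (x ^ 2 - 2) / 2]

/-- The symmetric coupling constants `A_{ab}`, with `A_{aa} = J_a`. -/
def coupA (x : ℝ) : Matrix (Fin 3) (Fin 3) ℝ :=
  !![1, 1, x - 1;
     1, 1, x - 1;
     x - 1, x - 1, (x ^ 2 - 2) / 2]

/-- The operator `s_j^a` at the site `j`. -/
def spinAt {N : ℕ} (j : Fin N) (a : Fin 3) : Op N := siteOp j (spin a)

/-- The operator `s_{j+1}^a` at the right neighbour of the site `j`, with the twisted boundary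
condition `s_{N+1}^a = ε_a s_1^a`. -/
def spinNext {N : ℕ} (ε : Fin 3 → ℝ) (j : Fin N) (a : Fin 3) : Op N :=
  if h : (j : ℕ) + 1 < N then spinAt ⟨(j : ℕ) + 1, h⟩ a
  else ((ε a : ℝ) : ℂ) • spinAt ⟨0, j.pos⟩ a

/-- The spin-one XXZ Hamiltonian with the boundary condition `s_{N+1}^a = ε_a s_1^a`. -/
def hamiltonian (N : ℕ) (x : ℝ) (ε : Fin 3 → ℝ) : Op N :=
  ∑ j : Fin N,
    ((∑ a, (coupJ x a : ℂ) • (spinAt j a * spinNext ε j a + (2 : ℂ) • spinAt j a ^ 2)) -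
      ∑ a, ∑ b, (coupA x a b : ℂ) •
        (spinAt j a * spinAt j b * spinNext ε j a * spinNext ε j b))

/-- The signs of the diagonal twist. -/
def diagTwist : Fin 3 → ℝ := ![-1, -1, 1]

/-- The signs of the anti-diagonal twist. -/
def antidiagTwist : Fin 3 → ℝ := ![1, -1, -1]

/-- The spin-flip operator `F`. -/
def spinFlip (N : ℕ) : Op N := tensorOp fun _ => !![0, 0, 1; 0, 1, 0; 1, 0, 0]

/-- The total magnetisation `M = ∑_j s_j³`. -/
def magnetisation (N : ℕ) : Op N := ∑ j : Fin N, spinAt j 2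

/-- The magnetisation `1, 0, -1` of the states up, zero, down of one site. -/
def siteMag : Fin 3 → ℤ := ![1, 0, -1]

/-- The operator `(-1)^M`, which multiplies a canonical basis state by `-1` to the power of its
(integer) total magnetisation. -/
def parity (N : ℕ) : Op N :=
  Matrix.diagonal fun σ => (-1 : ℂ) ^ (∑ j, siteMag (σ j))

/-- The canonical basis diagonalises `M`, with the eigenvalues used in `parity`. -/
theorem magnetisation_eq_diagonal (N : ℕ) :
    magnetisation N = Matrix.diagonal fun σ => ((∑ j, siteMag (σ j) : ℤ) : ℂ) := by
  have hs : spin 2 = Matrix.diagonal fun s => (siteMag s : ℂ) := by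
    ext i k
    fin_cases i <;> fin_cases k <;> simp [spin, siteMag]
  have hj : ∀ j : Fin N, spinAt j 2 = Matrix.diagonal fun σ => (siteMag (σ j) : ℂ) := by
    intro j
    ext σ τ
    simp only [spinAt, siteOp, tensorOp, Matrix.of_apply, hs]
    by_cases h : σ = τ
    · subst h
      rw [Matrix.diagonal_apply_eq, Finset.prod_eq_single j]
      · simp
      · intro k _ hk
        simp [Function.update_of_ne hk]
      · simp
    · rw [Matrix.diagonal_apply_ne _ h]
      obtain ⟨k, hk⟩ := Function.ne_iff.mp h
      refine Finset.prod_eq_zero (Finset.mem_univ k) ?_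
      by_cases hkj : k = j
      · subst hkj
        simp [Matrix.diagonal_apply_ne _ hk]
      · simp [Function.update_of_ne hkj, Matrix.one_apply_ne hk]
  ext σ τ
  simp only [magnetisation, hj, Matrix.sum_apply]
  by_cases h : σ = τ
  · subst h
    simp
  · simp [Matrix.diagonal_apply_ne _ h]

/-- The subsector of the state space on which the operator `P` acts as the scalar `c`. -/
def sector {N : ℕ} (P : Op N) (c : ℂ) : Submodule ℂ ((Fin N → Fin 3) → ℂ) :=
  Module.End.eigenspace (Matrix.toLin' P) c

/-- `H` maps the subsectors `P ≡ 1` and `P ≡ -1` to themselves, and its restrictions to them have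
the same non-zero eigenvalues, with the same degeneracies. A number `E` is an eigenvalue if and
only if its degeneracy, the dimension of the eigenspace, is not `0`. -/
def SameNonzeroSpectrum {N : ℕ} (H P : Op N) : Prop :=
  ∃ (hp : ∀ v ∈ sector P 1, Matrix.toLin' H v ∈ sector P 1)
    (hm : ∀ v ∈ sector P (-1), Matrix.toLin' H v ∈ sector P (-1)),
    ∀ E : ℂ, E ≠ 0 →
      Module.finrank ℂ (Module.End.eigenspace ((Matrix.toLin' H).restrict hp) E) =
        Module.finrank ℂ (Module.End.eigenspace ((Matrix.toLin' H).restrict hm) E)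

end

end SpinOneXXZ

/-!
Up to normalisation and an additive constant, the Hamiltonian is the logarithmic derivative of the
transfer matrix `T₁` with spin-one auxiliary space, at the point `u = 0` where `T₁` becomes a
twisted shift `S` of the sites. Let `T` be the transfer matrix with spin-1/2 auxiliary space and the
matching twist, and `P` the symmetry whose eigenspaces are compared.

* Decomposing `1/2 ⊗ 1/2 = 1 ⊕ 0` in the auxiliary space gives the fusion relation
  `T(u) T(u + 1) = T₁(u) - δ(u)ᴺ`, and the Yang-Baxter equation gives `[T(u), T₁(v)] = 0`.
* `P` anticommutes with `T(u)`: an auxiliary twist that implements `P` on the L-operators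
  anticommutes with the twist of `T`. Hence `tr (P Z T(u) T(u + 1)) = 0` for every `Z` that commutes
  with `T(u)`, that is, `tr (P Z T₁(u)) = δ(u)ᴺ tr (P Z)`.
* To first order at `u = 0`, and with `Z = Hᵏ S⁻¹`, this becomes `tr (P Hᵏ⁺¹) = 0` for all `k`.
  Expansions to first order are computations over the dual numbers.
* Since `H` is Hermitian, the projection to its eigenspace for `E ≠ 0` is a polynomial in `H`
  without constant term. Hence the trace of `P` times this projection, which is the difference of
  the two multiplicities, vanishes.

The L-operators contain a square root of `x` and degenerate at `x = 0`, where the claim follows by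
continuity.
-/

namespace SpinOneXXZ

open scoped Kronecker
open Matrix (traceLinearMap ofLinearEquiv)

section Multilinear

variable {R ι M M' : Type*} [CommRing R] [Fintype ι] [DecidableEq ι] [AddCommGroup M] [Module R M]
  [AddCommGroup M'] [Module R M']

theorem multilinearMap_smul_add_smul_of_sq_eq_zero (f : MultilinearMap R (fun _ : ι => M) M')
    {e : R} (he : e * e = 0) (c : R) (m h : ι → M) :
    f (c • m + e • h) =
      c ^ Fintype.card ι • f m + (e * c ^ (Fintype.card ι - 1)) • f.linearDeriv m h := by
  have second_order (s : Finset ι) (hs : 2 ≤ s.card) :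
      f (s.piecewise (e • h) (c • m)) = 0 := by
    have hz : s.piecewise (e • h) (c • m) =
        s.piecewise (fun i => e • s.piecewise h (c • m) i) (s.piecewise h (c • m)) := by
      funext i
      by_cases hi : i ∈ s <;> simp [hi]
    rw [hz, f.map_piecewise_smul (fun _ => e), Finset.prod_const,
      pow_eq_zero_of_le hs (by rw [sq, he]), zero_smul]
  have deriv : f.linearDeriv (c • m) h = c ^ (Fintype.card ι - 1) • f.linearDeriv m h := by
    simp only [MultilinearMap.linearDeriv_apply, f.map_update_smul_left, Finset.smul_sum]
  rw [f.map_add_eq_map_add_linearDeriv_add, (f.linearDeriv (c • m)).map_smul, deriv, smul_smul,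
    Finset.sum_eq_zero fun s hs => second_order s (Finset.mem_filter.mp hs).2, add_zero]
  congr 1
  exact (f.map_smul_univ (fun _ => c) m).trans (by simp)

end Multilinear

section MatrixProductOperators

variable {R : Type*} [CommRing R] {d l m n : Type*} {N : ℕ}

section

variable [Fintype m] [DecidableEq m] [Fintype n] [DecidableEq n]

theorem kronecker_prod_ofFn (f : Fin N → Matrix m m R) (g : Fin N → Matrix n n R) :
    (List.ofFn f).prod ⊗ₖ (List.ofFn g).prod = (List.ofFn fun j => f j ⊗ₖ g j).prod := by
  induction N with
  | zero => simp
  | succ N ih =>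
    simp only [List.ofFn_succ, List.prod_cons, Matrix.mul_kronecker_mul,
      ih (fun j => f j.succ) (fun j => g j.succ)]

theorem mul_prod_ofFn_of_intertwine {f : Fin N → Matrix m m R} {g : Fin N → Matrix n n R}
    {G : Matrix n m R} (h : ∀ j, G * f j = g j * G) :
    G * (List.ofFn f).prod = (List.ofFn g).prod * G := by
  induction N with
  | zero => simp
  | succ N ih =>
    simp only [List.ofFn_succ, List.prod_cons]
    rw [← Matrix.mul_assoc, h, Matrix.mul_assoc, ih fun j => h j.succ, Matrix.mul_assoc]

theorem sum_prod_ofFn {ι : Type*} [Fintype ι] (A : Fin N → ι → Matrix n n R) :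
    ∑ ρ : Fin N → ι, (List.ofFn fun j => A j (ρ j)).prod =
      (List.ofFn fun j => ∑ q, A j q).prod := by
  simpa only [MultilinearMap.mkPiAlgebraFin_apply] using
    ((MultilinearMap.mkPiAlgebraFin R N (Matrix n n R)).map_sum A).symm

theorem prod_ofFn_smul (c : Fin N → R) (f : Fin N → Matrix n n R) :
    (List.ofFn fun j => c j • f j).prod = (∏ j, c j) • (List.ofFn f).prod := by
  simpa only [MultilinearMap.mkPiAlgebraFin_apply] using
    (MultilinearMap.mkPiAlgebraFin R N (Matrix n n R)).map_smul_univ c f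

end

/-- The matrix product operator on `N` sites with the local matrices `W j s t`, where `s` and `t`
are states of the site `j`, and the twist `K`: its matrix elements are
`tr (K * W 0 σ₀ τ₀ * ⋯ * W (N - 1) σ_{N - 1} τ_{N - 1})`. It is multilinear in the local
matrices. -/
def mpo [Fintype n] [DecidableEq n] (K : Matrix n n R) :
    MultilinearMap R (fun _ : Fin N => d → d → Matrix n n R)
      (Matrix (Fin N → d) (Fin N → d) R) :=
  (ofLinearEquiv R).toLinearMap.compMultilinearMap <|
    .pi fun σ => .pi fun τ =>
      (traceLinearMap n R R ∘ₗ LinearMap.mulLeft R K).compMultilinearMap <|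
        (MultilinearMap.mkPiAlgebraFin R N (Matrix n n R)).compLinearMap fun j =>
          LinearMap.proj (τ j) ∘ₗ LinearMap.proj (σ j)

/-- The tensor product of one-site operators, over any commutative ring and with any set `d` of
states of a site. -/
def tensor (A : Fin N → Matrix d d R) : Matrix (Fin N → d) (Fin N → d) R :=
  Matrix.of fun σ τ => ∏ k, A k (σ k) (τ k)

theorem tensor_one [DecidableEq d] : tensor (fun _ : Fin N => (1 : Matrix d d R)) = 1 := by
  ext σ τ
  simp [tensor, Matrix.one_apply, Finset.prod_ite_zero, funext_iff]

theorem tensor_mul_tensor [Fintype d] (A B : Fin N → Matrix d d R) :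
    tensor A * tensor B = tensor fun j => A j * B j := by
  ext σ τ
  simp only [tensor, Matrix.mul_apply, Matrix.of_apply, ← Finset.prod_mul_distrib]
  exact (Fintype.prod_sum fun j q => A j (σ j) q * B j q (τ j)).symm

theorem map_tensor {S : Type*} [CommRing S] (f : R →+* S) (A : Fin N → Matrix d d R) :
    (tensor A).map f = tensor fun j => (A j).map f := by
  ext σ τ
  simp [tensor]

variable [Fintype m] [DecidableEq m] [Fintype n] [DecidableEq n]

theorem mpo_apply (K : Matrix n n R) (W : Fin N → d → d → Matrix n n R) (σ τ : Fin N → d) :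
    mpo K W σ τ = (K * (List.ofFn fun j => W j (σ j) (τ j)).prod).trace := by
  simp [mpo]

theorem mpo_neg (K : Matrix n n R) (W : Fin N → d → d → Matrix n n R) :
    mpo (-K) W = -mpo K W := by
  ext σ τ
  simp [mpo_apply]

theorem mpo_mul_mpo [Fintype d] (K : Matrix m m R) (W : Fin N → d → d → Matrix m m R)
    (K' : Matrix n n R) (W' : Fin N → d → d → Matrix n n R) :
    mpo K W * mpo K' W' = mpo (K ⊗ₖ K') fun j s t => ∑ q, W j s q ⊗ₖ W' j q t := by
  ext σ τ
  simp only [mpo_apply, Matrix.mul_apply, ← Matrix.trace_kronecker,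
    Matrix.mul_kronecker_mul, kronecker_prod_ofFn]
  rw [← Matrix.trace_sum, ← Finset.mul_sum,
    sum_prod_ofFn (fun j q => W j (σ j) q ⊗ₖ W' j q (τ j))]

theorem tensor_mul_mpo [Fintype d] (A : Fin N → Matrix d d R) (K : Matrix n n R)
    (W : Fin N → d → d → Matrix n n R) :
    tensor A * mpo K W = mpo K fun j s t => ∑ q, A j s q • W j q t := by
  ext σ τ
  simp only [mpo_apply, tensor, Matrix.mul_apply, Matrix.of_apply, ← smul_eq_mul,
    ← Matrix.trace_smul]
  rw [← Matrix.trace_sum]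
  simp only [smul_eq_mul, ← Matrix.mul_smul, ← prod_ofFn_smul]
  rw [← Finset.mul_sum, sum_prod_ofFn (fun j q => A j (σ j) q • W j q (τ j))]

theorem mpo_mul_tensor [Fintype d] (A : Fin N → Matrix d d R) (K : Matrix n n R)
    (W : Fin N → d → d → Matrix n n R) :
    mpo K W * tensor A = mpo K fun j s t => ∑ q, A j q t • W j s q := by
  ext σ τ
  simp only [mpo_apply, tensor, Matrix.mul_apply, Matrix.of_apply, mul_comm _ (∏ _, _)]
  simp only [← smul_eq_mul, ← Matrix.trace_smul]
  rw [← Matrix.trace_sum]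
  simp only [smul_eq_mul, ← Matrix.mul_smul, ← prod_ofFn_smul]
  rw [← Finset.mul_sum, sum_prod_ofFn (fun j q => A j q (τ j) • W j (σ j) q)]

theorem mpo_eq_of_intertwine {K : Matrix m m R} {W : Fin N → d → d → Matrix m m R}
    {K' : Matrix n n R} {W' : Fin N → d → d → Matrix n n R}
    (G : Matrix n m R) (G' : Matrix m n R) (hG : G' * G = 1) (hG' : G * G' = 1)
    (hK : G * K = K' * G) (hW : ∀ j s t, G * W j s t = W' j s t * G) : mpo K W = mpo K' W' := by
  ext σ τ
  simp only [mpo_apply]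
  set Q := (List.ofFn fun j => W j (σ j) (τ j)).prod
  set Q' := (List.ofFn fun j => W' j (σ j) (τ j)).prod
  have hQ : G * Q = Q' * G := mul_prod_ofFn_of_intertwine fun j => hW j _ _
  calc (K * Q).trace = (G' * (G * K) * Q).trace := by
        rw [← Matrix.mul_assoc, hG, Matrix.one_mul]
    _ = (G' * (K' * Q' * G)).trace := by
        rw [hK]; simp only [Matrix.mul_assoc, hQ]
    _ = (K' * Q').trace := by
        rw [Matrix.trace_mul_comm, Matrix.mul_assoc, hG', Matrix.mul_one]

theorem mpo_eq_add_of_invariant [Fintype l] [DecidableEq l]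
    {K : Matrix m m R} {W : Fin N → d → d → Matrix m m R}
    {K' : Matrix n n R} {W' : Fin N → d → d → Matrix n n R}
    {k : Matrix l l R} {w : Fin N → d → d → Matrix l l R}
    (V : Matrix m n R) (U : Matrix n m R) (v : Matrix m l R) (u : Matrix l m R)
    (hUV : U * V = 1) (huv : u * v = 1) (hsum : V * U + v * u = 1)
    (hK : K * V = V * K') (hW : ∀ j s t, W j s t * V = V * W' j s t)
    (hk : u * K = k * u) (hw : ∀ j s t, u * W j s t = w j s t * u) :
    mpo K W = mpo K' W' + mpo k w := by
  ext σ τ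
  simp only [mpo_apply, Matrix.add_apply]
  set Q := (List.ofFn fun j => W j (σ j) (τ j)).prod
  set Q' := (List.ofFn fun j => W' j (σ j) (τ j)).prod
  set q := (List.ofFn fun j => w j (σ j) (τ j)).prod
  have hQ : V * Q' = Q * V := mul_prod_ofFn_of_intertwine fun j => (hW j _ _).symm
  have hq : u * Q = q * u := mul_prod_ofFn_of_intertwine fun j => hw j _ _
  have subspace : (K * Q * (V * U)).trace = (K' * Q').trace := by
    rw [← Matrix.mul_assoc, Matrix.mul_assoc K, ← hQ, ← Matrix.mul_assoc K, hK,
      Matrix.trace_mul_comm, Matrix.mul_assoc V, ← Matrix.mul_assoc U, hUV, Matrix.one_mul]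
  have quotient : (K * Q * (v * u)).trace = (k * q).trace := by
    rw [Matrix.trace_mul_comm, Matrix.mul_assoc, ← Matrix.mul_assoc u, hk, Matrix.mul_assoc k, hq,
      ← Matrix.mul_assoc k, Matrix.trace_mul_comm, Matrix.mul_assoc, huv, Matrix.mul_one]
  rw [← subspace, ← quotient, ← Matrix.trace_add, ← Matrix.mul_add, hsum, Matrix.mul_one]

theorem mpo_scalar [DecidableEq d] (k c : R) :
    mpo (k • (1 : Matrix Unit Unit R))
      (fun (_ : Fin N) s t => (1 : Matrix d d R) s t • c • 1) = (k * c ^ N) • 1 := by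
  ext σ τ
  have : mpo (k • (1 : Matrix Unit Unit R)) (fun (_ : Fin N) s t =>
      (1 : Matrix d d R) s t • c • 1) σ τ = k * c ^ N * tensor (fun _ => 1) σ τ := by
    simp [mpo_apply, tensor, prod_ofFn_smul, smul_smul, List.ofFn_const, Finset.prod_mul_distrib]
    ring
  rw [this, tensor_one, Matrix.smul_apply, smul_eq_mul]

theorem map_mpo {S : Type*} [CommRing S] (f : R →+* S) (K : Matrix n n R)
    (W : Fin N → d → d → Matrix n n R) :
    (mpo K W).map f = mpo (K.map f) fun j s t => (W j s t).map f := by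
  ext σ τ
  have h : (List.ofFn fun j => (W j (σ j) (τ j)).map f).prod =
      (List.ofFn fun j => W j (σ j) (τ j)).prod.map f := by
    rw [← RingHom.mapMatrix_apply, map_list_prod, List.map_ofFn]
    rfl
  simp only [mpo_apply, Matrix.map_apply, h, ← Matrix.map_mul]
  exact AddMonoidHom.map_trace f.toAddMonoidHom _

end MatrixProductOperators

section LocalIdentities

variable {R : Type*} [CommRing R] {x : R}

/-- A value `u` of the spectral parameter, with the anisotropy `x = q + q⁻¹`, is recorded by the
quantum numbers `val = [u]` and `prev = [u - 1]`, where `[u] = (q ^ u - q⁻ᵘ) / (q - q⁻¹)`. These are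
linked by a quadratic relation, so that neither `q` nor a square root of `x² - 4` is needed, and
the definition makes sense over any commutative ring. -/
structure SpectralParameter (x : R) where
  val : R
  prev : R
  conic : val ^ 2 - x * val * prev + prev ^ 2 = 1

namespace SpectralParameter

/-- The quantum number `[u + 1]`. -/
def next (p : SpectralParameter x) : R := x * p.val - p.prev

/-- The spectral parameter `u + 1`. -/
def shift (p : SpectralParameter x) : SpectralParameter x where
  val := p.next
  prev := p.val
  conic := by linear_combination (norm := (simp only [next]; ring)) p.conic

/-- The spectral parameter `1 - u`. -/
def crossing (p : SpectralParameter x) : SpectralParameter x where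
  val := -p.prev
  prev := -p.val
  conic := by linear_combination p.conic

/-- The difference `u - v` of two spectral parameters. -/
def sub (p p' : SpectralParameter x) : SpectralParameter x where
  val := p.val * p'.next - p.next * p'.val
  prev := p.prev * p'.next - p.val * p'.val
  conic := by
    obtain ⟨b, c, h⟩ := p
    obtain ⟨b', c', h'⟩ := p'
    simp only [next]
    linear_combination (b' ^ 2 - x * b' * c' + c' ^ 2) * h + h'

/-- For `e² = 0`, the spectral parameter infinitesimally near `0` with `[u] = 2e`. -/
def near (x : R) {e : R} (he : e * e = 0) : SpectralParameter x where
  val := 2 * e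
  prev := e * x - 1
  conic := by linear_combination (4 - x ^ 2) * he

end SpectralParameter

open SpectralParameter

theorem forall_fin_three {p : Fin 3 → Prop} : (∀ i, p i) ↔ p 0 ∧ p 1 ∧ p 2 := by
  simp [Fin.forall_fin_succ]

/-- The six-vertex L-operator with spin-1/2 auxiliary space at a site of spin one, as a matrix on
the auxiliary space for each pair of states of the site. The parameter `r` is a square root
of `x`. -/
def lax (r : R) (p : SpectralParameter x) : Fin 3 → Fin 3 → Matrix (Fin 2) (Fin 2) R
  | 0, 0 => !![p.next, 0; 0, p.prev]
  | 0, 1 => !![0, 0; r, 0]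
  | 0, 2 => 0
  | 1, 0 => !![0, r; 0, 0]
  | 1, 1 => !![p.val, 0; 0, p.val]
  | 1, 2 => !![0, 0; r, 0]
  | 2, 0 => 0
  | 2, 1 => !![0, r; 0, 0]
  | 2, 2 => !![p.prev, 0; 0, p.next]

/-- The L-operator with spin-one auxiliary space at a site of spin one. -/
def fusedLax (p : SpectralParameter x) : Fin 3 → Fin 3 → Matrix (Fin 3) (Fin 3) R
  | 0, 0 => .diagonal ![p.next * (x * p.next - p.val), p.next * p.val, p.val * p.prev]
  | 0, 1 => !![0, 0, 0; x * p.next, 0, 0; 0, x * p.val, 0]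
  | 0, 2 => !![0, 0, 0; 0, 0, 0; x, 0, 0]
  | 1, 0 => !![0, x * p.next, 0; 0, 0, x * p.val; 0, 0, 0]
  | 1, 1 => .diagonal ![p.next * p.val, p.next * p.val + x, p.next * p.val]
  | 1, 2 => !![0, 0, 0; x * p.val, 0, 0; 0, x * p.next, 0]
  | 2, 0 => !![0, 0, x; 0, 0, 0; 0, 0, 0]
  | 2, 1 => !![0, x * p.val, 0; 0, 0, x * p.next; 0, 0, 0]
  | 2, 2 => .diagonal ![p.val * p.prev, p.next * p.val, p.next * (x * p.next - p.val)]

/-- The L-operator with spin-1/2 auxiliary space as a matrix that exchanges the order of its two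
spaces. -/
def laxSwap (r : R) (p : SpectralParameter x) : Matrix (Fin 3 × Fin 2) (Fin 2 × Fin 3) R :=
  Matrix.of fun i k => lax r p i.1 k.2 i.2 k.1

/-- The L-operator with spin-1/2 auxiliary space as a matrix that exchanges the order of its two
spaces, in the direction opposite to that of `laxSwap`. -/
def laxSwapRev (r : R) (p : SpectralParameter x) : Matrix (Fin 2 × Fin 3) (Fin 3 × Fin 2) R :=
  Matrix.of fun i k => lax r p i.2 k.1 i.1 k.2

namespace SpectralParameter

/-- The eigenvalue of the inversion relation between the spectral parameters `u` and `1 - u`. -/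
def inversion (p : SpectralParameter x) : R := p.next * (p.val - x * p.prev)

/-- The quantum determinant of the L-operator, which arises from the singlet in the product of
the values `u` and `u + 1` of the spectral parameter. -/
def qdet (p : SpectralParameter x) : R := p.prev * (x * p.next - p.val)

end SpectralParameter

/-- The inclusion of the triplet into the tensor square of the doublet, the middle vector
being scaled by `g`. -/
def tripletIn (g : R) : Matrix (Fin 2 × Fin 2) (Fin 3) R
  | (0, 0) => ![1, 0, 0]
  | (0, 1) => ![0, g, 0]
  | (1, 0) => ![0, g, 0]
  | (1, 1) => ![0, 0, 1]

variable (R) in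
/-- The singlet in the tensor square of the doublet. -/
def singlet : Matrix (Fin 2 × Fin 2) Unit R
  | (0, 0) => fun _ => 0
  | (0, 1) => fun _ => 1
  | (1, 0) => fun _ => -1
  | (1, 1) => fun _ => 0

/-- The boundary conditions of the spin chain. -/
inductive Twist
  | diagonal
  | antidiagonal

namespace Twist

/-- The other boundary condition: its twist of a spin-1/2 auxiliary space carries the sign change of
the transfer matrix under the symmetry `siteParity`. -/
def swap : Twist → Twist
  | diagonal => antidiagonal
  | antidiagonal => diagonal

variable (R)

/-- The twist of a spin-1/2 auxiliary space. -/
def half : Twist → Matrix (Fin 2) (Fin 2) R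
  | diagonal => !![1, 0; 0, -1]
  | antidiagonal => !![0, 1; 1, 0]

/-- The twist of a spin-one auxiliary space. -/
def one : Twist → Matrix (Fin 3) (Fin 3) R
  | diagonal => !![1, 0, 0; 0, -1, 0; 0, 0, 1]
  | antidiagonal => !![0, 0, 1; 0, 1, 0; 1, 0, 0]

/-- The one-site factor of the symmetry that distinguishes the two sectors: the spin flip for the
diagonal twist, and `(-1) ^ s³` for the anti-diagonal twist. -/
def siteParity : Twist → Matrix (Fin 3) (Fin 3) R
  | diagonal => !![0, 0, 1; 0, 1, 0; 1, 0, 0]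
  | antidiagonal => !![-1, 0, 0; 0, 1, 0; 0, 0, -1]

variable {R}

theorem half_mul_half (t : Twist) : t.half R * t.half R = 1 := by
  cases t <;> simp [half, ← Matrix.ext_iff, Fin.forall_fin_two, Matrix.one_apply]

theorem one_mul_one (t : Twist) : t.one R * t.one R = 1 := by
  cases t <;> simp [one, ← Matrix.ext_iff, forall_fin_three, Matrix.one_apply]

theorem siteParity_mul_siteParity (t : Twist) : t.siteParity R * t.siteParity R = 1 := by
  cases t <;> simp [siteParity, ← Matrix.ext_iff, forall_fin_three, Matrix.one_apply]

theorem half_kronecker_half_mul_tripletIn (t : Twist) (g : R) :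
    (t.half R ⊗ₖ t.half R) * tripletIn g = tripletIn g * t.one R := by
  ext ⟨i, i'⟩ k
  revert i i' k
  cases t <;> simp [Fin.forall_fin_two, forall_fin_three, half, one, tripletIn,
    Matrix.mul_apply, Fintype.sum_prod_type, Fin.sum_univ_three]

theorem tripletIn_transpose_mul_half_kronecker_half (t : Twist) (g : R) :
    (tripletIn g).transpose * (t.half R ⊗ₖ t.half R) = t.one R * (tripletIn g).transpose := by
  ext k ⟨i, i'⟩
  revert i i' k
  cases t <;> simp [Fin.forall_fin_two, forall_fin_three, half, one, tripletIn,
    Matrix.mul_apply, Fintype.sum_prod_type, Fin.sum_univ_three]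

theorem half_kronecker_half_mul_singlet (t : Twist) :
    (t.half R ⊗ₖ t.half R) * singlet R =
      singlet R * ((-1 : R) • (1 : Matrix Unit Unit R)) := by
  ext ⟨i, i'⟩ k
  revert i i' k
  cases t <;> simp [Fin.forall_fin_two, half, singlet, Matrix.mul_apply, Fintype.sum_prod_type]

theorem singlet_transpose_mul_half_kronecker_half (t : Twist) :
    (singlet R).transpose * (t.half R ⊗ₖ t.half R) =
      ((-1 : R) • (1 : Matrix Unit Unit R)) * (singlet R).transpose := by
  ext k ⟨i, i'⟩
  revert i i' k
  cases t <;> simp [Fin.forall_fin_two, half, singlet, Matrix.mul_apply, Fintype.sum_prod_type]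

theorem laxSwap_mul_half_kronecker_one (t : Twist) (r : R) (p : SpectralParameter x) :
    laxSwap r p * (t.half R ⊗ₖ t.one R) = (t.one R ⊗ₖ t.half R) * laxSwap r p := by
  ext ⟨i, i'⟩ ⟨k, k'⟩
  revert i i' k k'
  cases t <;> simp [Fin.forall_fin_two, forall_fin_three, laxSwap, half, one, lax,
    Matrix.mul_apply, Fintype.sum_prod_type, Fin.sum_univ_three]

theorem swap_half_mul_half (t : Twist) :
    t.swap.half R * t.half R = -(t.half R * t.swap.half R) := by
  cases t <;> simp [half, swap]

theorem swap_half_mul_sum_siteParity_smul_lax (t : Twist) (r : R) (p : SpectralParameter x) :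
    ∀ s s', t.swap.half R * (∑ q, t.siteParity R s q • lax r p q s') =
      (∑ q, t.siteParity R q s' • lax r p s q) * t.swap.half R := by
  simp only [forall_fin_three, Fin.sum_univ_three]
  cases t <;> simp [siteParity, lax, half, swap]

end Twist

theorem tripletIn_transpose_mul_tripletIn {g h : R} (hgh : 2 * (g * h) = 1) :
    (tripletIn g).transpose * tripletIn h = 1 := by
  ext k k'
  revert k k'
  simp [forall_fin_three, tripletIn, Matrix.mul_apply, Fintype.sum_prod_type, Matrix.one_apply]
  grind

theorem singlet_transpose_mul_singlet : (singlet R).transpose * singlet R = (2 : R) • 1 := by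
  ext k k'
  simp [singlet, Matrix.mul_apply, Fintype.sum_prod_type, one_add_one_eq_two]

theorem tripletIn_mul_transpose_add_singlet_mul_transpose {g h : R} (hgh : 2 * (g * h) = 1) :
    tripletIn h * (tripletIn g).transpose + (g * h) • singlet R * (singlet R).transpose = 1 := by
  ext ⟨i, i'⟩ ⟨k, k'⟩
  revert i i' k k'
  simp [Fin.forall_fin_two, tripletIn, singlet, Matrix.mul_apply, Fin.sum_univ_three,
    Matrix.one_apply]
  grind

theorem laxSwapRev_crossing_mul_laxSwap {r : R} (hr : r * r = x) (p : SpectralParameter x) :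
    laxSwapRev r p.crossing * laxSwap r p = p.inversion • 1 := by
  have := p.conic
  ext ⟨i, i'⟩ ⟨k, k'⟩
  revert i i' k k'
  simp [Fin.forall_fin_two, forall_fin_three, laxSwap, laxSwapRev, lax, crossing, next, inversion,
    Matrix.mul_apply, Fintype.sum_prod_type, Fin.sum_univ_three, Matrix.one_apply]
  grind

theorem singlet_transpose_mul_lax_kronecker_lax_shift {r : R} (hr : r * r = x)
    (p : SpectralParameter x) : ∀ s t,
    (singlet R).transpose * (∑ q, lax r p s q ⊗ₖ lax r p.shift q t) =
      ((1 : Matrix (Fin 3) (Fin 3) R) s t • p.qdet • (1 : Matrix Unit Unit R)) *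
        (singlet R).transpose := by
  have := p.conic
  rw [forall_fin_three]
  simp only [forall_fin_three]
  and_intros <;>
  · ext k ⟨i, i'⟩
    revert i i' k
    simp [Fin.forall_fin_two, lax, shift, next, qdet, singlet,
      Matrix.mul_apply, Fintype.sum_prod_type, Fin.sum_univ_three] <;>
    grind

theorem lax_shift_kronecker_lax_mul_singlet {r : R} (hr : r * r = x)
    (p : SpectralParameter x) : ∀ s t,
    (∑ q, lax r p.shift s q ⊗ₖ lax r p q t) * singlet R =
      singlet R * ((1 : Matrix (Fin 3) (Fin 3) R) s t • p.qdet • (1 : Matrix Unit Unit R)) := by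
  have := p.conic
  rw [forall_fin_three]
  simp only [forall_fin_three]
  and_intros <;>
  · ext ⟨i, i'⟩ k
    revert i i' k
    simp [Fin.forall_fin_two, lax, shift, next, qdet, singlet,
      Matrix.mul_apply, Fintype.sum_prod_type, Fin.sum_univ_three] <;>
    grind

theorem lax_kronecker_lax_shift_mul_tripletIn {r r' : R} (hr : r * r = x) (hr' : r * r' = 1)
    (p : SpectralParameter x) : ∀ s t,
    (∑ q, lax r p s q ⊗ₖ lax r p.shift q t) * tripletIn r' = tripletIn r' * fusedLax p s t := by
  have := p.conic
  rw [forall_fin_three]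
  simp only [forall_fin_three]
  and_intros <;>
  · ext ⟨i, i'⟩ k
    revert i i' k
    simp [Fin.forall_fin_two, forall_fin_three, lax, shift, next, Fin.sum_univ_three,
      Matrix.mul_apply, Fintype.sum_prod_type, tripletIn, fusedLax]
    grind

theorem tripletIn_transpose_mul_lax_shift_kronecker_lax {r r' : R} (hr : r * r = x)
    (hr' : r * r' = 1) (p : SpectralParameter x) : ∀ s t,
    (tripletIn r').transpose * (∑ q, lax r p.shift s q ⊗ₖ lax r p q t) =
      fusedLax p s t * (tripletIn r').transpose := by
  have := p.conic
  rw [forall_fin_three]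
  simp only [forall_fin_three]
  and_intros <;>
  · ext k ⟨i, i'⟩
    revert i i' k
    simp [Fin.forall_fin_two, forall_fin_three, lax, shift, next, Fin.sum_univ_three,
      Matrix.mul_apply, Fintype.sum_prod_type, tripletIn, fusedLax]
    grind

/-- The L-operator that exchanges two sites of spin one. -/
def exchangeLax (s t : Fin 3) : Matrix (Fin 3) (Fin 3) R :=
  Matrix.single t s 1

/-- The derivative of `fusedLax` at its shift point, where it is proportional to `exchangeLax`. -/
def densityLax (x : R) : Fin 3 → Fin 3 → Matrix (Fin 3) (Fin 3) R
  | 0, 0 => .diagonal ![2 * x ^ 2 - 2, 2, -2]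
  | 0, 1 => !![0, 0, 0; x ^ 2, 0, 0; 0, 2 * x, 0]
  | 0, 2 => 0
  | 1, 0 => !![0, x ^ 2, 0; 0, 0, 2 * x; 0, 0, 0]
  | 1, 1 => .diagonal ![2, 2, 2]
  | 1, 2 => !![0, 0, 0; 2 * x, 0, 0; 0, x ^ 2, 0]
  | 2, 0 => 0
  | 2, 1 => !![0, 2 * x, 0; 0, 0, x ^ 2; 0, 0, 0]
  | 2, 2 => .diagonal ![-2, 2, 2 * x ^ 2 - 2]

set_option maxHeartbeats 1000000 in
-- nine `6 × 6` matrices of polynomial identities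
theorem laxSwap_mul_kronecker_fusedLax {r : R} (hr : r * r = x) (p p' : SpectralParameter x) :
    ∀ s t, laxSwap r (p.sub p') * (∑ q, lax r p s q ⊗ₖ fusedLax p' q t) =
      (∑ q, fusedLax p' s q ⊗ₖ lax r p q t) * laxSwap r (p.sub p') := by
  obtain ⟨b, c, h⟩ := p
  obtain ⟨b', c', h'⟩ := p'
  subst hr
  rw [forall_fin_three]
  simp only [forall_fin_three]
  and_intros <;>
  · ext ⟨i, i'⟩ ⟨k, k'⟩
    revert i i' k k'
    simp [Fin.forall_fin_two, forall_fin_three, laxSwap, lax, Fin.sum_univ_three,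
      Matrix.mul_apply, Fintype.sum_prod_type, fusedLax, sub, next]
    grind

theorem fusedLax_near {e : R} (he : e * e = 0) : ∀ s t,
    fusedLax (near x he) s t = x • exchangeLax s t + e • densityLax x s t := by
  simp [← Matrix.ext_iff, forall_fin_three, fusedLax, exchangeLax, densityLax, Matrix.single_apply,
    near, next]
  grind

end LocalIdentities

open SpectralParameter

section TransferMatrices

variable {R : Type*} [CommRing R] {x : R}

/-- The transfer matrix with spin-1/2 auxiliary space. -/
def transfer (N : ℕ) (t : Twist) (r : R) (p : SpectralParameter x) :
    Matrix (Fin N → Fin 3) (Fin N → Fin 3) R :=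
  mpo (t.half R) fun _ => lax r p

/-- The transfer matrix with spin-one auxiliary space. -/
def fusedTransfer (N : ℕ) (t : Twist) (p : SpectralParameter x) :
    Matrix (Fin N → Fin 3) (Fin N → Fin 3) R :=
  mpo (t.one R) fun _ => fusedLax p

/-- The symmetry that distinguishes the two sectors: the spin flip for the diagonal twist, and
`(-1) ^ M` with the total magnetisation `M` for the anti-diagonal twist. -/
def symmetry (R : Type*) [CommRing R] (N : ℕ) (t : Twist) :
    Matrix (Fin N → Fin 3) (Fin N → Fin 3) R :=
  tensor fun _ => t.siteParity R

variable {N : ℕ} {t : Twist} {r : R}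

theorem transfer_mul_transfer_shift (hr : r * r = x) (hx : IsUnit x) (h2 : IsUnit (2 : R))
    (p : SpectralParameter x) :
    transfer N t r p * transfer N t r p.shift = fusedTransfer N t p - p.qdet ^ N • 1 := by
  obtain ⟨r', hr'⟩ := (isUnit_of_mul_isUnit_left (hr ▸ hx)).exists_right_inv
  obtain ⟨c, hc⟩ := h2.exists_right_inv
  have hrc : 2 * (c * r * r') = 1 := by linear_combination c * 2 * hr' + hc
  have hsinglet : (singlet R).transpose * ((c * r * r') • singlet R) = 1 := by
    rw [Matrix.mul_smul, singlet_transpose_mul_singlet, smul_smul, mul_comm, hrc, one_smul]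
  rw [transfer, transfer, mpo_mul_mpo,
    mpo_eq_add_of_invariant (K' := t.one R) (W' := fun _ => fusedLax p)
      (tripletIn r') (tripletIn (c * r)).transpose ((c * r * r') • singlet R) (singlet R).transpose
      (tripletIn_transpose_mul_tripletIn hrc) hsinglet
      (tripletIn_mul_transpose_add_singlet_mul_transpose hrc)
      (t.half_kronecker_half_mul_tripletIn r')
      (fun _ => lax_kronecker_lax_shift_mul_tripletIn hr hr' p)
      t.singlet_transpose_mul_half_kronecker_half
      (fun _ => singlet_transpose_mul_lax_kronecker_lax_shift hr p), mpo_scalar, fusedTransfer]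
  simp [sub_eq_add_neg]

theorem transfer_shift_mul_transfer (hr : r * r = x) (hx : IsUnit x) (h2 : IsUnit (2 : R))
    (p : SpectralParameter x) :
    transfer N t r p.shift * transfer N t r p = fusedTransfer N t p - p.qdet ^ N • 1 := by
  obtain ⟨r', hr'⟩ := (isUnit_of_mul_isUnit_left (hr ▸ hx)).exists_right_inv
  obtain ⟨c, hc⟩ := h2.exists_right_inv
  have hrc : 2 * (r' * (c * r)) = 1 := by linear_combination c * 2 * hr' + hc
  have hsinglet : (singlet R).transpose * ((r' * (c * r)) • singlet R) = 1 := by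
    rw [Matrix.mul_smul, singlet_transpose_mul_singlet, smul_smul, mul_comm, hrc, one_smul]
  rw [transfer, transfer, mpo_mul_mpo,
    mpo_eq_add_of_invariant (k := t.one R) (w := fun _ => fusedLax p)
      ((r' * (c * r)) • singlet R) (singlet R).transpose (tripletIn (c * r))
      (tripletIn r').transpose
      hsinglet (tripletIn_transpose_mul_tripletIn hrc)
      ((add_comm _ _).trans (tripletIn_mul_transpose_add_singlet_mul_transpose hrc))
      (by rw [Matrix.mul_smul, t.half_kronecker_half_mul_singlet, Matrix.smul_mul])
      (fun _ s s' => by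
        rw [Matrix.mul_smul, lax_shift_kronecker_lax_mul_singlet hr p, Matrix.smul_mul])
      (t.tripletIn_transpose_mul_half_kronecker_half r')
      (fun _ => tripletIn_transpose_mul_lax_shift_kronecker_lax hr hr' p), mpo_scalar,
    fusedTransfer]
  simp [sub_eq_add_neg, add_comm]

theorem transfer_commute_fusedTransfer (hr : r * r = x) {p p' : SpectralParameter x}
    (hp : IsUnit (p.sub p').inversion) : Commute (transfer N t r p) (fusedTransfer N t p') := by
  obtain ⟨u, hu⟩ := hp.exists_left_inv
  have left_inv : (u • laxSwapRev r (p.sub p').crossing) * laxSwap r (p.sub p') = 1 := by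
    rw [Matrix.smul_mul, laxSwapRev_crossing_mul_laxSwap hr, smul_smul, hu, one_smul]
  rw [commute_iff_eq, transfer, fusedTransfer, mpo_mul_mpo, mpo_mul_mpo]
  exact mpo_eq_of_intertwine _ _ left_inv
    ((Matrix.mul_eq_one_comm_of_card_eq _ _ _ (by simp)).mp left_inv)
    (t.laxSwap_mul_half_kronecker_one r _)
    fun _ => laxSwap_mul_kronecker_fusedLax hr p p'

theorem symmetry_mul_symmetry : symmetry R N t * symmetry R N t = 1 := by
  simp only [symmetry, tensor_mul_tensor, t.siteParity_mul_siteParity, tensor_one]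

theorem symmetry_mul_transfer (p : SpectralParameter x) :
    symmetry R N t * transfer N t r p = -(transfer N t r p * symmetry R N t) := by
  rw [symmetry, transfer, tensor_mul_mpo, mpo_mul_tensor, ← mpo_neg]
  refine mpo_eq_of_intertwine _ _ t.swap.half_mul_half t.swap.half_mul_half ?_
    fun _ => t.swap_half_mul_sum_siteParity_smul_lax r p
  rw [t.swap_half_mul_half, Matrix.neg_mul]

theorem symmetry_commute_fusedTransfer (hr : r * r = x) (hx : IsUnit x) (h2 : IsUnit (2 : R))
    (p : SpectralParameter x) : Commute (symmetry R N t) (fusedTransfer N t p) := by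
  rw [← sub_add_cancel (fusedTransfer N t p) (p.qdet ^ N • 1),
    ← transfer_mul_transfer_shift hr hx h2]
  refine .add_right ?_ ((Commute.one_right _).smul_right _)
  rw [commute_iff_eq, ← mul_assoc, symmetry_mul_transfer, neg_mul, mul_assoc,
    symmetry_mul_transfer, mul_neg, neg_neg, mul_assoc]

theorem trace_mul_eq_zero_of_anticommute {ι : Type*} [Fintype ι]
    (h2 : IsUnit (2 : R)) {P Z A B : Matrix ι ι R} (hPA : P * A = -(A * P)) (hAZ : Commute A Z)
    (hAB : Commute A B) : (P * Z * (A * B)).trace = 0 := by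
  have h : (P * Z * (A * B)).trace = -(P * Z * (A * B)).trace := calc
    _ = (P * A * (Z * B)).trace := by simp only [mul_assoc, hAZ.left_comm]
    _ = -(P * (Z * B) * A).trace := by
      rw [hPA, neg_mul, Matrix.trace_neg, mul_assoc, Matrix.trace_mul_comm]
    _ = -(P * Z * (A * B)).trace := by rw [hAB.eq]; simp only [mul_assoc]
  exact h2.mul_right_eq_zero.mp (by linear_combination h)

theorem trace_symmetry_mul_fusedTransfer (hr : r * r = x) (hx : IsUnit x) (h2 : IsUnit (2 : R))
    {p : SpectralParameter x} {Z : Matrix (Fin N → Fin 3) (Fin N → Fin 3) R}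
    (hZ : Commute (transfer N t r p) Z) :
    (symmetry R N t * Z * fusedTransfer N t p).trace =
      p.qdet ^ N * (symmetry R N t * Z).trace := by
  have h := trace_mul_eq_zero_of_anticommute h2 (symmetry_mul_transfer p) hZ
    ((transfer_mul_transfer_shift hr hx h2 p).trans (transfer_shift_mul_transfer hr hx h2 p).symm)
  rw [transfer_mul_transfer_shift hr hx h2, mul_sub, Matrix.trace_sub, sub_eq_zero] at h
  simpa using h

end TransferMatrices

section DualNumbers

variable {R : Type*} [CommRing R] {x : R}

/-- The operator that moves the state of each site to the next site, composed with the twist at the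
boundary. -/
def twistedShift (R : Type*) [CommRing R] (N : ℕ) (t : Twist) :
    Matrix (Fin N → Fin 3) (Fin N → Fin 3) R :=
  mpo (t.one R) fun _ => exchangeLax

/-- The derivative of the fused transfer matrix at its shift point, up to a power of `x`. -/
def densityTransfer (N : ℕ) (t : Twist) (x : R) : Matrix (Fin N → Fin 3) (Fin N → Fin 3) R :=
  (mpo (t.one R)).linearDeriv (fun _ => exchangeLax) fun _ => densityLax x

variable {N : ℕ} {t : Twist} {r : R}

theorem fusedTransfer_near {e : R} (he : e * e = 0) :
    fusedTransfer N t (near x he) =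
      x ^ N • twistedShift R N t + (e * x ^ (N - 1)) • densityTransfer N t x := by
  have h : (fun _ : Fin N => fusedLax (near x he)) =
      x • (fun _ => exchangeLax) + e • fun _ => densityLax x := by
    funext _ s t
    exact fusedLax_near he s t
  rw [fusedTransfer, h, multilinearMap_smul_add_smul_of_sq_eq_zero _ he, Fintype.card_fin]
  rfl

/-- The image of a spectral parameter under a ring homomorphism. -/
def SpectralParameter.map {S : Type*} [CommRing S] (f : R →+* S) (p : SpectralParameter x) :
    SpectralParameter (f x) where
  val := f p.val
  prev := f p.prev
  conic := by simpa using congrArg f p.conic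

section Map

variable {S : Type*} [CommRing S] (f : R →+* S)

theorem Twist.map_half : (t.half R).map f = t.half S := by
  cases t <;> simp [Twist.half, ← Matrix.ext_iff, Fin.forall_fin_two]

theorem Twist.map_one : (t.one R).map f = t.one S := by
  cases t <;> simp [Twist.one, ← Matrix.ext_iff, forall_fin_three]

theorem Twist.map_siteParity : (t.siteParity R).map f = t.siteParity S := by
  cases t <;> simp [Twist.siteParity, ← Matrix.ext_iff, forall_fin_three]

theorem map_lax (p : SpectralParameter x) (s t : Fin 3) :
    (lax r p s t).map f = lax (f r) (p.map f) s t := by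
  revert s t
  simp [forall_fin_three, ← Matrix.ext_iff, Fin.forall_fin_two, lax, SpectralParameter.map, next]

theorem map_exchangeLax (s t : Fin 3) :
    (exchangeLax s t : Matrix _ _ R).map f = exchangeLax s t := by
  simp [exchangeLax, Matrix.map_single]

theorem map_densityLax (s t : Fin 3) : (densityLax x s t).map f = densityLax (f x) s t := by
  revert s t
  simp [forall_fin_three, ← Matrix.ext_iff, densityLax, map_ofNat f 2]

theorem map_symmetry : (symmetry R N t).map f = symmetry S N t := by
  simp only [symmetry, map_tensor, Twist.map_siteParity]

theorem map_transfer (p : SpectralParameter x) :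
    (transfer N t r p).map f = transfer N t (f r) (p.map f) := by
  simp only [transfer, map_mpo, map_lax, Twist.map_half]

theorem map_twistedShift : (twistedShift R N t).map f = twistedShift S N t := by
  simp only [twistedShift, map_mpo, map_exchangeLax, Twist.map_one]

theorem map_densityTransfer : (densityTransfer N t x).map f = densityTransfer N t (f x) := by
  simp only [densityTransfer, MultilinearMap.linearDeriv_apply, ← RingHom.mapMatrix_apply, map_sum]
  refine Finset.sum_congr rfl fun i _ => ?_
  rw [RingHom.mapMatrix_apply, map_mpo, Twist.map_one]
  congr 1
  funext j s s'
  obtain rfl | hj := eq_or_ne j i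
  · simp only [Function.update_self, map_densityLax]
  · simp only [Function.update_of_ne hj, map_exchangeLax]

end Map

open scoped DualNumber

/-- The infinitesimal spectral parameter with `[u] = 2ε` over the dual numbers. -/
def SpectralParameter.nearEps (x : R) : SpectralParameter (TrivSqZeroExt.inlHom R R x) :=
  near (TrivSqZeroExt.inlHom R R x) DualNumber.eps_mul_eps

theorem commute_of_map_inl_commute {ι : Type*} [Fintype ι] {A B C : Matrix ι ι R}
    (h : Commute (A.map (TrivSqZeroExt.inlHom R R))
      (B.map (TrivSqZeroExt.inlHom R R) + (ε : R[ε]) • C.map (TrivSqZeroExt.inlHom R R))) :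
    Commute A B ∧ Commute A C := by
  have h' (i j : ι) := congrFun₂ h.eq i j
  constructor <;> ext i j
  · simpa [Matrix.mul_apply, TrivSqZeroExt.fst_sum] using congrArg TrivSqZeroExt.fst (h' i j)
  · simpa [Matrix.mul_apply, TrivSqZeroExt.snd_sum, mul_comm] using
      congrArg TrivSqZeroExt.snd (h' i j)

theorem fusedTransfer_near_eps :
    fusedTransfer N t (nearEps x) =
      (x ^ N • twistedShift R N t).map (TrivSqZeroExt.inlHom R R) +
        (ε : R[ε]) • (x ^ (N - 1) • densityTransfer N t x).map (TrivSqZeroExt.inlHom R R) := by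
  have map_smul' (c : R) (A : Matrix (Fin N → Fin 3) (Fin N → Fin 3) R) :
      (c • A).map (TrivSqZeroExt.inlHom R R) =
        TrivSqZeroExt.inlHom R R c • A.map (TrivSqZeroExt.inlHom R R) :=
    Matrix.map_smul' _ _ _ (map_mul _)
  rw [nearEps, fusedTransfer_near, map_smul', map_smul', map_twistedShift, map_densityTransfer,
    smul_smul, map_pow, map_pow]

theorem commute_twistedShift_densityTransfer_of_commute_fusedTransfer (hx : IsUnit x)
    {A : Matrix (Fin N → Fin 3) (Fin N → Fin 3) R}
    (h : Commute (A.map (TrivSqZeroExt.inlHom R R)) (fusedTransfer N t (nearEps x))) :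
    Commute A (twistedShift R N t) ∧ Commute A (densityTransfer N t x) := by
  rw [fusedTransfer_near_eps] at h
  obtain ⟨hS, hD⟩ := commute_of_map_inl_commute h
  exact ⟨(Commute.smul_right_iff (g := (hx.pow _).unit)).mp hS,
    (Commute.smul_right_iff (g := (hx.pow _).unit)).mp hD⟩

theorem transfer_commute_twistedShift_densityTransfer (hr : r * r = x) (hx : IsUnit x)
    {p : SpectralParameter x} (hp : IsUnit p.inversion) :
    Commute (transfer N t r p) (twistedShift R N t) ∧
      Commute (transfer N t r p) (densityTransfer N t x) := by
  refine commute_twistedShift_densityTransfer_of_commute_fusedTransfer hx ?_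
  rw [map_transfer]
  refine transfer_commute_fusedTransfer (by rw [← map_mul, hr]) ?_
  rw [TrivSqZeroExt.isUnit_iff_isUnit_fst]
  convert hp using 1
  simp [inversion, sub, nearEps, near, next, SpectralParameter.map]

theorem isUnit_two_of_ringHom {S : Type*} [Semiring S] (f : R →+* S) (h2 : IsUnit (2 : R)) :
    IsUnit (2 : S) :=
  map_ofNat f 2 ▸ h2.map f

theorem symmetry_commute_twistedShift_densityTransfer (hr : r * r = x) (hx : IsUnit x)
    (h2 : IsUnit (2 : R)) :
    Commute (symmetry R N t) (twistedShift R N t) ∧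
      Commute (symmetry R N t) (densityTransfer N t x) := by
  refine commute_twistedShift_densityTransfer_of_commute_fusedTransfer hx ?_
  rw [map_symmetry]
  exact symmetry_commute_fusedTransfer ((map_mul _ r r).symm.trans (congrArg _ hr)) (hx.map _)
    (isUnit_two_of_ringHom (TrivSqZeroExt.inlHom R R) h2) _

theorem trace_map_mul_eq_of_trace_mul_eq {ι : Type*} [Fintype ι]
    {A B C : Matrix ι ι R} {d : R[ε]}
    (h : (A.map (TrivSqZeroExt.inlHom R R) * (B.map (TrivSqZeroExt.inlHom R R) +
      (ε : R[ε]) • C.map (TrivSqZeroExt.inlHom R R))).trace =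
        d * (A.map (TrivSqZeroExt.inlHom R R)).trace) :
    (A * B).trace = d.fst * A.trace ∧ (A * C).trace = d.snd * A.trace := by
  constructor
  · simpa [Matrix.trace, Matrix.mul_apply, TrivSqZeroExt.fst_sum] using
      congrArg TrivSqZeroExt.fst h
  · simpa [Matrix.trace, Matrix.mul_apply, TrivSqZeroExt.fst_sum, TrivSqZeroExt.snd_sum,
      mul_comm] using congrArg TrivSqZeroExt.snd h

theorem qdet_near {e : R} (he : e * e = 0) : (near x he).qdet = e + e - x := by
  simp only [qdet, near, next]
  linear_combination (x ^ 3 - 2 * x) * he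

theorem trace_symmetry_mul_densityTransfer (hr : r * r = x) (hx : IsUnit x) (h2 : IsUnit (2 : R))
    {Z : Matrix (Fin N → Fin 3) (Fin N → Fin 3) R}
    (hZ : Commute (transfer N t (TrivSqZeroExt.inlHom R R r) (nearEps x))
      (Z.map (TrivSqZeroExt.inlHom R R))) :
    (symmetry R N t * Z * densityTransfer N t x).trace =
      -(2 * N) * (symmetry R N t * Z * twistedShift R N t).trace := by
  have h := trace_symmetry_mul_fusedTransfer ((map_mul _ r r).symm.trans (congrArg _ hr))
    (hx.map _) (isUnit_two_of_ringHom (TrivSqZeroExt.inlHom R R) h2) hZ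
  rw [fusedTransfer_near_eps, ← map_symmetry (TrivSqZeroExt.inlHom R R), ← Matrix.map_mul] at h
  obtain ⟨h_fst, h_snd⟩ := trace_map_mul_eq_of_trace_mul_eq h
  have hS : x ^ N * (symmetry R N t * Z * twistedShift R N t).trace =
      (-x) ^ N * (symmetry R N t * Z).trace := by
    simpa [nearEps, qdet_near] using h_fst
  have hD : x ^ (N - 1) * (symmetry R N t * Z * densityTransfer N t x).trace =
      N * ((-x) ^ (N - 1) * (1 + 1)) * (symmetry R N t * Z).trace := by
    simpa [nearEps, qdet_near, TrivSqZeroExt.snd_pow] using h_snd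
  obtain _ | N := N
  · simp [densityTransfer]
  · refine (hx.pow (N + 1)).mul_left_cancel ?_
    push_cast at hD ⊢
    linear_combination x * hD + 2 * (N + 1) * hS

theorem commute_of_two_mul_mul_eq {A : Type*} [Ring A] (h2 : IsUnit (2 : A)) {a s d h : A} {n : ℕ}
    (hs : IsUnit s) (hh : 2 * (s * h) = d + 2 * n * s) (hsa : Commute a s) (hda : Commute a d) :
    Commute a h := by
  have commute_of_mul {u b : A} (hu : IsUnit u) (hau : Commute a u) (hub : Commute a (u * b)) :
      Commute a b := by
    obtain ⟨u, rfl⟩ := hu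
    simpa using hau.units_inv_right.mul_right hub
  refine commute_of_mul hs hsa (commute_of_mul h2 (Commute.ofNat_right a 2) ?_)
  rw [hh]
  exact hda.add_right (((Commute.ofNat_right a 2).mul_right (Nat.commute_cast a n)).mul_right hsa)

theorem symmetry_commute_of_twistedShift_mul_eq (hr : r * r = x) (hx : IsUnit x)
    (h2 : IsUnit (2 : R)) (hS : IsUnit (twistedShift R N t))
    {H : Matrix (Fin N → Fin 3) (Fin N → Fin 3) R}
    (hH : 2 * (twistedShift R N t * H) = densityTransfer N t x + 2 * N * twistedShift R N t) :
    Commute (symmetry R N t) H := by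
  obtain ⟨hPS, hPD⟩ := symmetry_commute_twistedShift_densityTransfer hr hx h2
  exact commute_of_two_mul_mul_eq (isUnit_two_of_ringHom (algebraMap R _) h2) hS hH hPS hPD

theorem transfer_near_commute_of_twistedShift_mul_eq (hr : r * r = x) (hx : IsUnit x)
    (h2 : IsUnit (2 : R)) (hS : IsUnit (twistedShift R N t))
    {H : Matrix (Fin N → Fin 3) (Fin N → Fin 3) R}
    (hH : 2 * (twistedShift R N t * H) = densityTransfer N t x + 2 * N * twistedShift R N t) :
    Commute (transfer N t (TrivSqZeroExt.inlHom R R r) (nearEps x))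
        ((twistedShift R N t).map (TrivSqZeroExt.inlHom R R)) ∧
      Commute (transfer N t (TrivSqZeroExt.inlHom R R r) (nearEps x))
        (H.map (TrivSqZeroExt.inlHom R R)) := by
  have inversion_near : IsUnit (nearEps x).inversion := by
    rw [TrivSqZeroExt.isUnit_iff_isUnit_fst]
    convert hx using 1
    simp [inversion, nearEps, near, next]
  obtain ⟨hAS, hAD⟩ := transfer_commute_twistedShift_densityTransfer (N := N) (t := t)
    ((map_mul _ r r).symm.trans (congrArg _ hr)) (hx.map (TrivSqZeroExt.inlHom R R)) inversion_near
  rw [← map_twistedShift (TrivSqZeroExt.inlHom R R)] at hAS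
  rw [← map_densityTransfer (TrivSqZeroExt.inlHom R R)] at hAD
  refine ⟨hAS, commute_of_two_mul_mul_eq (n := N)
    (isUnit_two_of_ringHom ((algebraMap R[ε] _).comp (TrivSqZeroExt.inlHom R R)) h2)
    (hS.map (TrivSqZeroExt.inlHom R R).mapMatrix) ?_ hAS hAD⟩
  simpa only [map_mul, map_add, map_natCast, map_ofNat, RingHom.mapMatrix_apply] using
    congrArg (TrivSqZeroExt.inlHom R R).mapMatrix hH

theorem trace_symmetry_mul_pow_of_twistedShift_mul_eq (hr : r * r = x) (hx : IsUnit x)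
    (h2 : IsUnit (2 : R)) (hS : IsUnit (twistedShift R N t))
    {H : Matrix (Fin N → Fin 3) (Fin N → Fin 3) R}
    (hH : 2 * (twistedShift R N t * H) = densityTransfer N t x + 2 * N * twistedShift R N t)
    (k : ℕ) : (symmetry R N t * H ^ (k + 1)).trace = 0 := by
  obtain ⟨hAS, hAH⟩ := transfer_near_commute_of_twistedShift_mul_eq hr hx h2 hS hH
  obtain ⟨S, hS⟩ := hS
  rw [← hS] at hAS hH
  have hAZ : Commute (transfer N t (TrivSqZeroExt.inlHom R R r) (nearEps x))
      ((H ^ k * S⁻¹.val).map (TrivSqZeroExt.inlHom R R)) := by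
    rw [← RingHom.mapMatrix_apply, map_mul, map_pow]
    exact (hAH.pow_right k).mul_right <|
      Commute.units_inv_right
        (u := Units.map (TrivSqZeroExt.inlHom R R).mapMatrix.toMonoidHom S) hAS
  have h := trace_symmetry_mul_densityTransfer hr hx h2 hAZ
  have natCast_mul_eq_smul : 2 * (N : Matrix (Fin N → Fin 3) (Fin N → Fin 3) R) * S.val =
      (2 * N : R) • twistedShift R N t := by
    rw [Algebra.smul_def, map_mul, map_ofNat, map_natCast, hS]
  refine h2.mul_right_eq_zero.mp ?_
  calc 2 * (symmetry R N t * H ^ (k + 1)).trace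
      = (symmetry R N t * (H ^ k * S⁻¹.val) * (2 * (S * H))).trace := by
        simp [pow_succ, mul_assoc, two_mul, mul_add]
    _ = 0 := by
        rw [hH, natCast_mul_eq_smul, mul_add, Matrix.mul_smul, Matrix.trace_add, Matrix.trace_smul,
          h, smul_eq_mul, neg_mul, neg_add_cancel]

end DualNumbers

section Bonds

variable {R d : Type*} {n : ℕ}

/-- The cyclic relabelling of the sites of a configuration. -/
def rotate : (Fin (n + 1) → d) ≃ (Fin (n + 1) → d) :=
  (Equiv.addRight (1 : Fin (n + 1))).symm.arrowCongr (Equiv.refl d)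

theorem rotate_apply (σ : Fin (n + 1) → d) (j : Fin (n + 1)) : rotate σ j = σ (j + 1) := rfl

variable [CommRing R]

/-- The local matrices of the matrix product operators that pass on the state of each site to the
next one: `A` acts on the state that a site receives, and `B` on the state that it passes on. -/
def bondLax (A B : Matrix d d R) (s t : d) : Matrix d d R :=
  Matrix.vecMulVec (fun a => A a t) (B s)

theorem bondLax_apply (A B : Matrix d d R) (s t a b : d) :
    bondLax A B s t a b = A a t * B s b := rfl

variable [Fintype d]

theorem tensor_submatrix_rotate_mul_tensor (A C : Fin (n + 1) → Matrix d d R) :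
    (tensor A).submatrix id rotate * tensor C =
      (tensor fun j => A j * C (j + 1)).submatrix id rotate := by
  have tensor_rotate : tensor C = (tensor fun j => C (j + 1)).submatrix rotate rotate := by
    ext σ τ
    exact (Equiv.prod_comp (Equiv.addRight (1 : Fin (n + 1))) fun j => C j (σ j) (τ j)).symm
  rw [tensor_rotate, Matrix.submatrix_mul_equiv, tensor_mul_tensor]

variable [DecidableEq d]

theorem prod_ofFn_vecMulVec (a b : Fin (n + 1) → d → R) :
    (List.ofFn fun j => Matrix.vecMulVec (a j) (b j)).prod =
      (∏ j : Fin n, b j.castSucc ⬝ᵥ a j.succ) • Matrix.vecMulVec (a 0) (b (Fin.last n)) := by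
  induction n with
  | zero => simp
  | succ n ih =>
    rw [List.ofFn_succ, List.prod_cons, ih (fun j => a j.succ) fun j => b j.succ, Matrix.mul_smul,
      Matrix.vecMulVec_mul_vecMulVec, Matrix.vecMulVec_smul, smul_smul, Fin.prod_univ_succ,
      mul_comm]
    simp only [Fin.succ_castSucc, Fin.succ_last, Fin.castSucc_zero]

/-- The one-site operators that are the twist `K` at the last site and the identity elsewhere. -/
def boundaryTwist (K : Matrix d d R) : Fin (n + 1) → Matrix d d R :=
  Pi.mulSingle (Fin.last n) K

theorem boundaryTwist_mul_boundaryTwist {K : Matrix d d R} (hK : K * K = 1) (j : Fin (n + 1)) :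
    boundaryTwist K j * boundaryTwist K j = 1 := by
  rw [boundaryTwist, ← Pi.mul_apply, ← Pi.mulSingle_mul, hK, Pi.mulSingle_one, Pi.one_apply]

theorem mpo_bondLax (K : Matrix d d R) (A B : Fin (n + 1) → Matrix d d R) :
    mpo K (fun j => bondLax (A j) (B j)) =
      (tensor fun j => B j * boundaryTwist K j * A (j + 1)).submatrix id rotate := by
  ext σ τ
  rw [mpo_apply]
  simp only [bondLax, prod_ofFn_vecMulVec, Matrix.mul_smul, Matrix.trace_smul, smul_eq_mul]
  rw [Matrix.submatrix_apply, tensor, Matrix.of_apply, Fin.prod_univ_castSucc]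
  congr 1
  · refine Finset.prod_congr rfl fun j _ => ?_
    simp [boundaryTwist, rotate_apply, Matrix.mul_apply, dotProduct, (Fin.castSucc_lt_last j).ne]
  · rw [Matrix.mul_vecMulVec, Matrix.trace_vecMulVec, dotProduct_comm, Matrix.mul_assoc]
    simp [boundaryTwist, rotate_apply, Matrix.mul_apply, dotProduct, Matrix.mulVec]

theorem isUnit_mpo_bondLax_one {K : Matrix d d R} (hK : K * K = 1) :
    IsUnit (mpo K fun _ : Fin (n + 1) => bondLax 1 1) := by
  have hT : tensor (boundaryTwist K) * tensor (boundaryTwist K) =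
      (1 : Matrix (Fin (n + 1) → d) _ R) := by
    simp only [tensor_mul_tensor, boundaryTwist_mul_boundaryTwist hK, tensor_one]
  refine IsUnit.of_mul_eq_one ((tensor (boundaryTwist K)).submatrix rotate id) ?_
  simp only [mpo_bondLax, one_mul, mul_one]
  rw [Matrix.submatrix_mul_equiv]
  exact congrArg (Matrix.submatrix · id id) hT

theorem mpo_bondLax_one_mul {K : Matrix d d R} (hK : K * K = 1) (j : Fin (n + 2))
    (A B : Matrix d d R) :
    mpo K (fun _ => bondLax 1 1) * (tensor (Pi.mulSingle j A) *
        tensor (Pi.mulSingle (j + 1) (boundaryTwist K j * B * boundaryTwist K j))) =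
      mpo K (Function.update (fun _ => bondLax 1 1) j (bondLax A B)) := by
  have update_bondLax : Function.update (fun _ => bondLax 1 1) j (bondLax A B) =
      fun i => bondLax (Pi.mulSingle (M := fun _ => Matrix d d R) j A i)
        (Pi.mulSingle (M := fun _ => Matrix d d R) j B i) := by
    funext i
    rcases eq_or_ne i j with rfl | h <;> simp [*]
  rw [update_bondLax, mpo_bondLax, mpo_bondLax, tensor_mul_tensor,
    tensor_submatrix_rotate_mul_tensor]
  congr 2
  funext i
  rcases eq_or_ne i j with rfl | h
  · simp [← mul_assoc, boundaryTwist_mul_boundaryTwist hK]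
  · simp [h]

end Bonds

section Hamiltonian

theorem exchangeLax_eq_bondLax {R : Type*} [CommRing R] :
    (exchangeLax : Fin 3 → Fin 3 → Matrix (Fin 3) (Fin 3) R) = bondLax 1 1 := by
  ext s t a b
  simp only [exchangeLax, bondLax_apply, Matrix.single_apply, Matrix.one_apply, mul_ite, mul_one,
    mul_zero, ← ite_and]
  grind

theorem spin_zero : spin 0 = ((1 / √2 : ℝ) : ℂ) • !![0, 1, 0; 1, 0, 1; 0, 1, 0] := rfl

theorem spin_one : spin 1 = ((1 / √2 : ℝ) : ℂ) •
    !![0, -Complex.I, 0; Complex.I, 0, -Complex.I; 0, Complex.I, 0] := rfl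

theorem spin_two : spin 2 = !![1, 0, 0; 0, 0, 0; 0, 0, -1] := rfl

theorem two_smul_sum_bondLax (x : ℝ) :
    (2 : ℂ) • ((∑ a, (coupJ x a : ℂ) • (bondLax (spin a) (spin a) + bondLax (spin a ^ 2) 1 +
        bondLax 1 (spin a ^ 2))) -
      ∑ a, ∑ b, (coupA x a b : ℂ) • bondLax (spin a * spin b) (spin a * spin b)) =
      densityLax (x : ℂ) + (2 : ℂ) • exchangeLax := by
  have h : ((1 / √2 : ℝ) : ℂ) * ((1 / √2 : ℝ) : ℂ) = 1 / 2 := by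
    rw [← Complex.ofReal_mul, div_mul_div_comm, Real.mul_self_sqrt (by norm_num)]
    norm_num
  have hI := Complex.I_mul_I
  simp only [pow_two, Fin.sum_univ_three]
  rw [spin_zero, spin_one, spin_two]
  simp only [coupJ, coupA]
  generalize ((1 / √2 : ℝ) : ℂ) = c at h
  ext s t i j
  revert s t i j
  simp [forall_fin_three, bondLax_apply, densityLax, exchangeLax, Matrix.one_apply,
    Matrix.single_apply]
  grind

section SiteOp

variable {N : ℕ} (j : Fin N) (A B : Matrix (Fin 3) (Fin 3) ℂ)

theorem siteOp_eq_tensor : siteOp j A = tensor (Pi.mulSingle j A) := rfl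

theorem siteOp_one : siteOp j 1 = 1 := by
  rw [siteOp_eq_tensor, Pi.mulSingle_one]
  exact tensor_one

theorem siteOp_mul_siteOp : siteOp j A * siteOp j B = siteOp j (A * B) := by
  simp only [siteOp_eq_tensor, tensor_mul_tensor, Pi.mulSingle_mul, Pi.mul_def]

theorem siteOp_smul (c : ℂ) : siteOp j (c • A) = c • siteOp j A := by
  ext σ τ
  simp only [siteOp, tensorOp, Matrix.smul_apply, Matrix.of_apply, smul_eq_mul,
    ← Finset.mul_prod_erase _ _ (Finset.mem_univ j), Function.update_self, mul_assoc]
  congr 2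
  refine Finset.prod_congr rfl fun k hk => ?_
  rw [Function.update_of_ne (Finset.ne_of_mem_erase hk),
    Function.update_of_ne (Finset.ne_of_mem_erase hk)]

theorem siteOp_commute {j k : Fin N} (hjk : j ≠ k) : Commute (siteOp j A) (siteOp k B) := by
  simp only [siteOp_eq_tensor, Commute, SemiconjBy, tensor_mul_tensor]
  exact congrArg tensor (Pi.mulSingle_commute (f := fun _ => Matrix (Fin 3) (Fin 3) ℂ) hjk A B)

theorem conjTranspose_siteOp : (siteOp j A).conjTranspose = siteOp j A.conjTranspose := by
  ext σ τ
  simp only [siteOp, tensorOp, Matrix.conjTranspose_apply, Matrix.of_apply, star_prod]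
  refine Finset.prod_congr rfl fun k _ => ?_
  rcases eq_or_ne k j with rfl | h
  · simp
  · simp [h, ← Matrix.conjTranspose_apply]

end SiteOp

end Hamiltonian

section TwistedBonds

variable (t : Twist) (a : Fin 3)

/-- The signs of the boundary condition with twist `t`, in the order of `spin`. -/
def Twist.sign : Twist → Fin 3 → ℝ
  | .diagonal => diagTwist
  | .antidiagonal => antidiagTwist

theorem Twist.sign_mul_sign : t.sign a * t.sign a = 1 := by
  revert a
  cases t <;> simp [forall_fin_three, sign, diagTwist, antidiagTwist]

theorem Twist.one_mul_spin_mul_one :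
    t.one ℂ * spin a * t.one ℂ = (t.sign a : ℂ) • spin a := by
  revert a
  cases t <;> simp [forall_fin_three, Twist.one, sign, diagTwist, antidiagTwist, spin_zero,
    spin_one, spin_two, ← Matrix.ext_iff]

theorem Twist.one_mul_spin_sq_mul_one : t.one ℂ * spin a ^ 2 * t.one ℂ = spin a ^ 2 :=
  calc t.one ℂ * spin a ^ 2 * t.one ℂ
      = t.one ℂ * spin a * t.one ℂ * (t.one ℂ * spin a * t.one ℂ) := by
        simp only [pow_two, ← mul_assoc]
        rw [mul_assoc _ (t.one ℂ) (t.one ℂ), Twist.one_mul_one, mul_one]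
    _ = spin a ^ 2 := by
        rw [Twist.one_mul_spin_mul_one, smul_mul_smul_comm, ← Complex.ofReal_mul,
          Twist.sign_mul_sign, Complex.ofReal_one, one_smul, pow_two]

variable {n : ℕ} (j : Fin (n + 2)) (A B : Matrix (Fin 3) (Fin 3) ℂ)

/-- The operator `A` at the site `j` times the operator `B` at the right neighbour of `j`, where `B`
is conjugated by the twist if that neighbour is reached across the boundary. -/
def bondOp : Op (n + 2) :=
  siteOp j A * siteOp (j + 1) (boundaryTwist (t.one ℂ) j * B * boundaryTwist (t.one ℂ) j)

theorem twistedShift_mul_bondOp :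
    twistedShift ℂ (n + 2) t * bondOp t j A B =
      (mpo (t.one ℂ)).toLinearMap (fun _ => exchangeLax) j (bondLax A B) := by
  rw [twistedShift, exchangeLax_eq_bondLax]
  exact mpo_bondLax_one_mul t.one_mul_one j A B

theorem spinNext_sign :
    spinNext t.sign j a =
      siteOp (j + 1) (boundaryTwist (t.one ℂ) j * spin a * boundaryTwist (t.one ℂ) j) := by
  rcases eq_or_ne j (Fin.last (n + 1)) with rfl | hj
  · simp [spinNext, spinAt, boundaryTwist, t.one_mul_spin_mul_one, siteOp_smul, -Complex.coe_smul]
  · have hlt : (j : ℕ) + 1 < n + 2 := by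
      have := Fin.val_lt_last hj
      omega
    have next_eq : (⟨(j : ℕ) + 1, hlt⟩ : Fin (n + 2)) = j + 1 :=
      Fin.ext (Fin.val_add_one_of_lt' hlt).symm
    simp [spinNext, spinAt, hlt, next_eq, boundaryTwist, hj]

theorem spinAt_mul_spinNext : spinAt j a * spinNext t.sign j a = bondOp t j (spin a) (spin a) := by
  rw [spinAt, spinNext_sign, bondOp]

theorem spinAt_mul_spinAt_mul_spinNext_mul_spinNext (b : Fin 3) :
    spinAt j a * spinAt j b * spinNext t.sign j a * spinNext t.sign j b =
      bondOp t j (spin a * spin b) (spin a * spin b) := by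
  rw [mul_assoc, spinNext_sign, spinNext_sign, spinAt, spinAt, siteOp_mul_siteOp,
    siteOp_mul_siteOp, bondOp]
  congr 2
  simp only [← mul_assoc]
  rw [mul_assoc _ (boundaryTwist (t.one ℂ) j) (boundaryTwist (t.one ℂ) j),
    boundaryTwist_mul_boundaryTwist t.one_mul_one, mul_one]

theorem sum_spinAt_sq :
    ∑ j : Fin (n + 2), (2 : ℂ) • spinAt j a ^ 2 =
      ∑ j, (bondOp t j (spin a ^ 2) 1 + bondOp t j 1 (spin a ^ 2)) := by
  have left_sq (j : Fin (n + 2)) : bondOp t j (spin a ^ 2) 1 = spinAt j a ^ 2 := by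
    rw [bondOp, mul_one, boundaryTwist_mul_boundaryTwist t.one_mul_one, siteOp_one, mul_one, spinAt,
      pow_two, pow_two, siteOp_mul_siteOp]
  have right_sq (j : Fin (n + 2)) : bondOp t j 1 (spin a ^ 2) = spinAt (j + 1) a ^ 2 := by
    have conj_sq : boundaryTwist (t.one ℂ) j * spin a ^ 2 * boundaryTwist (t.one ℂ) j =
        spin a ^ 2 := by
      rcases eq_or_ne j (Fin.last (n + 1)) with rfl | hj
      · simp [boundaryTwist, t.one_mul_spin_sq_mul_one]
      · simp [boundaryTwist, hj]
    rw [bondOp, conj_sq, siteOp_one, one_mul, spinAt, pow_two, pow_two, siteOp_mul_siteOp]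
  have sum_next : ∑ j : Fin (n + 2), spinAt (j + 1) a ^ 2 = ∑ j : Fin (n + 2), spinAt j a ^ 2 :=
    Equiv.sum_comp (Equiv.addRight (1 : Fin (n + 2))) fun j => spinAt j a ^ 2
  simp only [left_sq, right_sq, Finset.sum_add_distrib, sum_next, two_smul]

theorem hamiltonian_eq_sum_bondOp (x : ℝ) :
    hamiltonian (n + 2) x t.sign = ∑ j,
      ((∑ a, (coupJ x a : ℂ) • (bondOp t j (spin a) (spin a) + bondOp t j (spin a ^ 2) 1 +
        bondOp t j 1 (spin a ^ 2))) -
      ∑ a, ∑ b, (coupA x a b : ℂ) • bondOp t j (spin a * spin b) (spin a * spin b)) := by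
  simp only [hamiltonian, Finset.sum_sub_distrib, spinAt_mul_spinAt_mul_spinNext_mul_spinNext]
  congr 1
  rw [Finset.sum_comm, Finset.sum_comm (s := (Finset.univ : Finset (Fin (n + 2))))]
  refine Finset.sum_congr rfl fun a _ => ?_
  rw [← Finset.smul_sum, ← Finset.smul_sum]
  congr 1
  simp only [spinAt_mul_spinNext t, add_assoc]
  rw [Finset.sum_add_distrib, sum_spinAt_sq t, ← Finset.sum_add_distrib]

theorem two_mul_twistedShift_mul_hamiltonian (n : ℕ) (x : ℝ) :
    2 * (twistedShift ℂ (n + 2) t * hamiltonian (n + 2) x t.sign) =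
      densityTransfer (n + 2) t (x : ℂ) + 2 * (n + 2 : ℕ) * twistedShift ℂ (n + 2) t := by
  let L (j : Fin (n + 2)) := (mpo (t.one ℂ)).toLinearMap (fun _ => exchangeLax) j
  have map_exchangeLax (j : Fin (n + 2)) : L j exchangeLax = twistedShift ℂ (n + 2) t :=
    congrArg (mpo (t.one ℂ)) (Function.update_eq_self j _)
  have two_mul_eq_smul (X : Op (n + 2)) : 2 * X = (2 : ℂ) • X := by rw [two_mul, two_smul]
  calc 2 * (twistedShift ℂ (n + 2) t * hamiltonian (n + 2) x t.sign)
      = ∑ j, L j (densityLax (x : ℂ) + (2 : ℂ) • exchangeLax) := by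
        simp only [← two_smul_sum_bondLax, hamiltonian_eq_sum_bondOp, two_mul_eq_smul, map_smul,
          map_sub, map_sum, map_add, Finset.mul_sum, Finset.smul_sum, mul_sub, Matrix.mul_smul,
          mul_add, twistedShift_mul_bondOp, L]
    _ = densityTransfer (n + 2) t (x : ℂ) + 2 * (n + 2 : ℕ) * twistedShift ℂ (n + 2) t := by
        simp only [map_add, map_smul, map_exchangeLax, Finset.sum_add_distrib, Finset.sum_const,
          Finset.card_univ, Fintype.card_fin, two_mul_eq_smul, smul_mul_assoc, smul_comm _ (2 : ℂ),
          nsmul_eq_mul, L, MultilinearMap.toLinearMap_apply, densityTransfer,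
          MultilinearMap.linearDeriv_apply]

theorem isUnit_twistedShift (n : ℕ) : IsUnit (twistedShift ℂ (n + 2) t) := by
  rw [twistedShift, exchangeLax_eq_bondLax]
  exact isUnit_mpo_bondLax_one t.one_mul_one

end TwistedBonds

section Multiplicities

variable {K V : Type*} [Field K] [AddCommGroup V] [Module K V] {f g P : Module.End K V}

theorem isProj_inf_mul {p q : Submodule K V} (hf : LinearMap.IsProj p f) (hg : LinearMap.IsProj q g)
    (hfg : Commute f g) : LinearMap.IsProj (p ⊓ q) (f * g) where
  map_mem v := ⟨hf.map_mem _, hfg.eq ▸ hg.map_mem _⟩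
  map_id v hv := by rw [Module.End.mul_apply, hg.map_id v hv.2, hf.map_id v hv.1]

theorem isProj_eigenspace_of_mul_self_eq_one [NeZero (2 : K)] (hP : P * P = 1) {c : K}
    (hc : c * c = 1) : LinearMap.IsProj (P.eigenspace c) ((2⁻¹ : K) • (1 + c • P)) where
  map_mem v := by
    have hPv : P (P v) = v := congrArg (· v) hP
    simp only [Module.End.mem_eigenspace_iff, LinearMap.smul_apply, LinearMap.add_apply,
      Module.End.one_apply, map_smul, map_add, hPv, smul_add, smul_smul]
    rw [add_comm]
    linear_combination (norm := module) (-(2⁻¹ : K) * hc) • P v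
  map_id v hv := by
    rw [Module.End.mem_eigenspace_iff] at hv
    simp only [LinearMap.smul_apply, LinearMap.add_apply, Module.End.one_apply, hv, smul_smul, hc,
      one_smul]
    rw [← two_smul K v, inv_smul_smul₀ two_ne_zero]

theorem isProj_eigenspace_aeval {E : K} {p : Polynomial K}
    (hp : Polynomial.aeval f ((.X - .C E) * p) = 0) (hpE : p.eval E = 1) :
    LinearMap.IsProj (f.eigenspace E) (Polynomial.aeval f p) where
  map_mem v := by
    rw [Module.End.mem_eigenspace_iff, ← sub_eq_zero]
    simpa using congrArg (· v) hp
  map_id v hv := by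
    rw [Module.End.aeval_apply_of_mem_apply_eq_smul (Module.End.mem_eigenspace_iff.mp hv), hpE,
      one_smul]

theorem exists_aeval_sub_mul_eq_zero [FiniteDimensional K V] (hf : f.IsSemisimple) (E : K) :
    ∃ p : Polynomial K, Polynomial.aeval f ((.X - .C E) * p) = 0 ∧ p.eval E ≠ 0 := by
  by_cases hE : (minpoly K f).IsRoot E
  · obtain ⟨p, hp⟩ := Polynomial.dvd_iff_isRoot.mpr hE
    refine ⟨p, hp ▸ minpoly.aeval K f, fun hpE => ?_⟩
    obtain ⟨q, rfl⟩ := Polynomial.dvd_iff_isRoot.mpr hpE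
    have sq_dvd : (.X - .C E) * (.X - .C E) ∣ minpoly K f := ⟨q, by rw [hp, mul_assoc]⟩
    exact Polynomial.not_isUnit_X_sub_C E (hf.minpoly_squarefree _ sq_dvd)
  · exact ⟨minpoly K f, by rw [map_mul, minpoly.aeval, mul_zero], hE⟩

theorem exists_isProj_eigenspace_aeval_X_mul [FiniteDimensional K V] (hf : f.IsSemisimple) {E : K}
    (hE : E ≠ 0) :
    ∃ q : Polynomial K, LinearMap.IsProj (f.eigenspace E) (Polynomial.aeval f (.X * q)) := by
  obtain ⟨p, hp, hpE⟩ := exists_aeval_sub_mul_eq_zero hf E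
  refine ⟨.C (E * p.eval E)⁻¹ * p, isProj_eigenspace_aeval ?_ ?_⟩
  · rw [show (.X - .C E) * (.X * (.C (E * p.eval E)⁻¹ * p)) =
      .X * .C (E * p.eval E)⁻¹ * ((.X - .C E) * p) by ring, map_mul, hp, mul_zero]
  · simp only [Polynomial.eval_mul, Polynomial.eval_X, Polynomial.eval_C]
    field_simp

theorem finrank_eigenspace_restrict [FiniteDimensional K V] [NeZero (2 : K)] (hP : P * P = 1)
    {E c : K} (hc : c * c = 1) (hg : LinearMap.IsProj (f.eigenspace E) g) (hPg : Commute P g)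
    (h : ∀ v ∈ P.eigenspace c, f v ∈ P.eigenspace c) :
    (Module.finrank K (Module.End.eigenspace (f.restrict h) E) : K) =
      2⁻¹ * (LinearMap.trace K V g + c * LinearMap.trace K V (P * g)) := by
  have hcomm : Commute ((2⁻¹ : K) • (1 + c • P)) g :=
    ((Commute.one_left g).add_left (hPg.smul_left c)).smul_left _
  have htrace := (isProj_inf_mul (isProj_eigenspace_of_mul_self_eq_one hP hc) hg hcomm).trace
  rw [← Submodule.finrank_map_subtype_eq, ← Submodule.inf_genEigenspace f _ h, ← htrace]
  simp only [smul_mul_assoc, add_mul, one_mul, map_smul, map_add, smul_eq_mul]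

theorem trace_mul_aeval_X_mul_eq_zero (h : ∀ k, LinearMap.trace K V (P * f ^ (k + 1)) = 0)
    (q : Polynomial K) : LinearMap.trace K V (P * Polynomial.aeval f (.X * q)) = 0 := by
  rw [map_mul (Polynomial.aeval f), Polynomial.aeval_X, Polynomial.aeval_eq_sum_range]
  simp only [Finset.mul_sum, map_sum, mul_smul_comm, ← pow_succ', map_smul, h, smul_zero,
    Finset.sum_const_zero]

theorem finrank_eigenspace_restrict_eq [FiniteDimensional K V] [CharZero K] (hf : f.IsSemisimple)
    (hP : P * P = 1) (hPf : Commute P f) (htr : ∀ k, LinearMap.trace K V (P * f ^ (k + 1)) = 0)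
    (hplus : ∀ v ∈ P.eigenspace 1, f v ∈ P.eigenspace 1)
    (hminus : ∀ v ∈ P.eigenspace (-1), f v ∈ P.eigenspace (-1)) {E : K} (hE : E ≠ 0) :
    Module.finrank K (Module.End.eigenspace (f.restrict hplus) E) =
      Module.finrank K (Module.End.eigenspace (f.restrict hminus) E) := by
  obtain ⟨q, hq⟩ := exists_isProj_eigenspace_aeval_X_mul hf hE
  have hPq : Commute P (Polynomial.aeval f (.X * q)) :=
    Algebra.commute_of_mem_adjoin_singleton_of_commute
      (Polynomial.aeval_mem_adjoin_singleton K f) hPf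
  rw [← Nat.cast_inj (R := K), finrank_eigenspace_restrict hP (one_mul 1) hq hPq hplus,
    finrank_eigenspace_restrict hP (by norm_num) hq hPq hminus,
    trace_mul_aeval_X_mul_eq_zero htr q, mul_zero, mul_zero]

theorem isSemisimple_toLin'_of_isHermitian {𝕜 n : Type*} [RCLike 𝕜] [Fintype n] [DecidableEq n]
    {A : Matrix n n 𝕜} (hA : A.IsHermitian) : Module.End.IsSemisimple (Matrix.toLin' A) := by
  have semisimple_toEuclideanLin := Module.End.isFinitelySemisimple_iff_isSemisimple.mp
    (Matrix.isSymmetric_toEuclideanLin_iff.mpr hA).isFinitelySemisimple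
  have squarefree := semisimple_toEuclideanLin.minpoly_squarefree
  rw [Matrix.toEuclideanLin, Matrix.toLpLin_eq_toLin, Matrix.minpoly_toLin, ← Matrix.minpoly_toLin']
    at squarefree
  exact Module.End.isSemisimple_of_squarefree_aeval_eq_zero squarefree (minpoly.aeval 𝕜 _)

end Multiplicities

theorem isHermitian_spin (a : Fin 3) : (spin a).IsHermitian := by
  revert a
  simp [forall_fin_three, Matrix.IsHermitian, spin_zero, spin_one, spin_two, ← Matrix.ext_iff]

theorem isHermitian_spinAt {N : ℕ} (j : Fin N) (a : Fin 3) : (spinAt j a).IsHermitian := by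
  rw [spinAt, Matrix.IsHermitian, conjTranspose_siteOp, isHermitian_spin a]

section Hermitian

variable {n : ℕ} (ε : Fin 3 → ℝ) (j : Fin (n + 2)) (a b : Fin 3)

theorem isHermitian_spinNext : (spinNext ε j a).IsHermitian := by
  rw [spinNext]
  split_ifs with h
  · exact isHermitian_spinAt _ a
  · rw [Matrix.IsHermitian, Matrix.conjTranspose_smul, isHermitian_spinAt _ a, RCLike.star_def,
      Complex.conj_ofReal]

theorem spinAt_commute_spinNext : Commute (spinAt j a) (spinNext ε j b) := by
  rw [spinNext]
  split_ifs with h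
  · exact siteOp_commute _ _ (Fin.ne_of_val_ne (Nat.ne_of_lt (Nat.lt_succ_self j)))
  · refine (siteOp_commute _ _ (Fin.ne_of_val_ne ?_)).smul_right _
    change (j : ℕ) ≠ 0
    omega

theorem conjTranspose_spinAt_mul_spinAt_mul_spinNext_mul_spinNext :
    (spinAt j a * spinAt j b * spinNext ε j a * spinNext ε j b).conjTranspose =
      spinAt j b * spinAt j a * spinNext ε j b * spinNext ε j a := by
  have hcomm := ((spinAt_commute_spinNext ε j b b).mul_left
    (spinAt_commute_spinNext ε j a b)).mul_right
      ((spinAt_commute_spinNext ε j b a).mul_left (spinAt_commute_spinNext ε j a a))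
  simp only [Matrix.conjTranspose_mul, (isHermitian_spinAt j _).eq, (isHermitian_spinNext ε j _).eq]
  simpa only [mul_assoc] using hcomm.eq.symm

theorem isHermitian_hamiltonian (x : ℝ) : (hamiltonian (n + 2) x ε).IsHermitian := by
  have coupA_symm (a b : Fin 3) : coupA x a b = coupA x b a := by
    fin_cases a <;> fin_cases b <;> rfl
  have exchange (j : Fin (n + 2)) (a : Fin 3) :
      (spinAt j a * spinNext ε j a).conjTranspose = spinAt j a * spinNext ε j a :=
    ((isHermitian_spinAt j a).commute_iff (isHermitian_spinNext ε j a)).mp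
      (spinAt_commute_spinNext ε j a a)
  simp only [Matrix.IsHermitian, hamiltonian, Matrix.conjTranspose_sum, Matrix.conjTranspose_sub,
    Matrix.conjTranspose_smul, Matrix.conjTranspose_add, Matrix.conjTranspose_pow, exchange,
    conjTranspose_spinAt_mul_spinAt_mul_spinNext_mul_spinNext, (isHermitian_spinAt _ _).eq,
    RCLike.star_def, Complex.conj_ofReal, map_ofNat]
  refine Finset.sum_congr rfl fun j _ => congrArg₂ (· - ·) rfl (Finset.sum_comm.trans ?_)
  simp only [coupA_symm]

end Hermitian

theorem continuous_hamiltonian (N : ℕ) (ε : Fin 3 → ℝ) :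
    Continuous fun x => hamiltonian N x ε := by
  have continuous_coupJ : ∀ a, Continuous fun x => (coupJ x a : ℂ) := by
    simp only [forall_fin_three, coupJ, Matrix.cons_val]
    and_intros <;> fun_prop
  have continuous_coupA : ∀ a b, Continuous fun x => (coupA x a b : ℂ) := by
    simp only [forall_fin_three, coupA, Matrix.of_apply, Matrix.cons_val]
    and_intros <;> fun_prop
  unfold hamiltonian
  fun_prop

section NonzeroSpectrum

variable (t : Twist) (n : ℕ) (x : ℝ)

theorem symmetry_commute_hamiltonian_and_trace_eq_zero_of_ne_zero {x : ℝ} (hx : x ≠ 0) (k : ℕ) :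
    Commute (symmetry ℂ (n + 2) t) (hamiltonian (n + 2) x t.sign) ∧
      (symmetry ℂ (n + 2) t * hamiltonian (n + 2) x t.sign ^ (k + 1)).trace = 0 := by
  obtain ⟨r, hr⟩ := IsAlgClosed.exists_eq_mul_self (x : ℂ)
  have isUnit_x : IsUnit (x : ℂ) := (Complex.ofReal_ne_zero.mpr hx).isUnit
  have isUnit_two : IsUnit (2 : ℂ) := two_ne_zero.isUnit
  have hS := isUnit_twistedShift t n
  have hH := two_mul_twistedShift_mul_hamiltonian t n x
  exact ⟨symmetry_commute_of_twistedShift_mul_eq hr.symm isUnit_x isUnit_two hS hH,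
    trace_symmetry_mul_pow_of_twistedShift_mul_eq hr.symm isUnit_x isUnit_two hS hH k⟩

theorem symmetry_commute_hamiltonian :
    Commute (symmetry ℂ (n + 2) t) (hamiltonian (n + 2) x t.sign) := by
  have hcont := continuous_hamiltonian (n + 2) t.sign
  exact congrFun (Continuous.ext_on (dense_compl_singleton 0) (continuous_const.mul hcont)
    (hcont.mul continuous_const) fun _ hy =>
      (symmetry_commute_hamiltonian_and_trace_eq_zero_of_ne_zero t n hy 0).1) x

theorem trace_symmetry_mul_hamiltonian_pow (k : ℕ) :
    (symmetry ℂ (n + 2) t * hamiltonian (n + 2) x t.sign ^ (k + 1)).trace = 0 := by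
  have hcont := continuous_hamiltonian (n + 2) t.sign
  exact congrFun (Continuous.ext_on (dense_compl_singleton 0)
    (continuous_const.mul (hcont.pow (k + 1))).matrix_trace continuous_const fun _ hy =>
      (symmetry_commute_hamiltonian_and_trace_eq_zero_of_ne_zero t n hy k).2) x

theorem sameNonzeroSpectrum_hamiltonian :
    SameNonzeroSpectrum (hamiltonian (n + 2) x t.sign) (symmetry ℂ (n + 2) t) := by
  have hPP : Matrix.toLin' (symmetry ℂ (n + 2) t) * Matrix.toLin' (symmetry ℂ (n + 2) t) = 1 := by
    rw [Module.End.mul_eq_comp, ← Matrix.toLin'_mul, symmetry_mul_symmetry, Matrix.toLin'_one]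
    rfl
  have hPH : Commute (Matrix.toLin' (symmetry ℂ (n + 2) t))
      (Matrix.toLin' (hamiltonian (n + 2) x t.sign)) :=
    (symmetry_commute_hamiltonian t n x).map Matrix.toLinAlgEquiv'
  have htr (k : ℕ) : LinearMap.trace ℂ _ (Matrix.toLin' (symmetry ℂ (n + 2) t) *
      Matrix.toLin' (hamiltonian (n + 2) x t.sign) ^ (k + 1)) = 0 := by
    rw [← Matrix.toLin'_pow, Module.End.mul_eq_comp, ← Matrix.toLin'_mul, Matrix.trace_toLin'_eq,
      trace_symmetry_mul_hamiltonian_pow]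
  have hinv (c : ℂ) := Module.End.mapsTo_genEigenspace_of_comm hPH c 1
  exact ⟨hinv 1, hinv (-1), fun _ => finrank_eigenspace_restrict_eq
    (isSemisimple_toLin'_of_isHermitian (isHermitian_hamiltonian t.sign x)) hPP hPH htr _ _⟩

end NonzeroSpectrum

theorem zpow_sum {ι K : Type*} [CommGroupWithZero K] {c : K} (hc : c ≠ 0) (s : Finset ι)
    (f : ι → ℤ) : c ^ (∑ i ∈ s, f i) = ∏ i ∈ s, c ^ f i := by
  classical
  induction s using Finset.induction_on with
  | empty => simp
  | insert i s hi ih => rw [Finset.sum_insert hi, Finset.prod_insert hi, zpow_add₀ hc, ih]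

theorem parity_eq_symmetry (N : ℕ) : parity N = symmetry ℂ N .antidiagonal := by
  have siteParity_apply : ∀ s t, (Twist.siteParity ℂ .antidiagonal s t : ℂ) =
      if s = t then (-1) ^ siteMag s else 0 := by
    simp [forall_fin_three, Twist.siteParity, siteMag]
  ext σ τ
  simp only [parity, symmetry, tensor, Matrix.of_apply, siteParity_apply, Finset.prod_ite_zero,
    Matrix.diagonal_apply, funext_iff, Finset.mem_univ, true_implies,
    zpow_sum (neg_ne_zero.mpr (one_ne_zero (α := ℂ)))]

end SpinOneXXZ

theorem mainTheorem11 (N : ℕ) (hN : 2 ≤ N) (x : ℝ) :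
    SpinOneXXZ.SameNonzeroSpectrum
        (SpinOneXXZ.hamiltonian N x SpinOneXXZ.antidiagTwist) (SpinOneXXZ.parity N) ∧
      SpinOneXXZ.SameNonzeroSpectrum
        (SpinOneXXZ.hamiltonian N x SpinOneXXZ.diagTwist) (SpinOneXXZ.spinFlip N) := by
  obtain ⟨n, rfl⟩ := Nat.exists_eq_add_of_le' hN
  rw [SpinOneXXZ.parity_eq_symmetry]
  exact ⟨SpinOneXXZ.sameNonzeroSpectrum_hamiltonian .antidiagonal n x,
    SpinOneXXZ.sameNonzeroSpectrum_hamiltonian .diagonal n x⟩
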